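/- An instance of $\mathcal S$-MaxAgree is a graph on $n$ vertices in which each pair $i\ne j$ of vertices carries a rational weight $w(i,j)\in\mathcal S$, where the set $\mathcal S=\mathcal S(n)$ may depend on $n$ (positive weight: edge labelled $+$; negative weight: edge labelled $-$; weight $0$: non-edge). A clustering is a partition $C$ of the vertices, and its value $w(C)$ is the total weight of the $+$ edges inside clusters plus the total absolute weight of the $-$ edges across clusters. A clustering $C$ is within a factor $\rho$ of the optimum if $w(C')\le\rho\, w(C)$ for all clusterings $C'$. Say that $\mathcal S$-MaxAgree is approximable within the factor $\rho=\rho(n)$ if there is a randomized algorithm, running in time polynomial in the length of the input (weights are written as fractions in binary) for all outcomes of its fair coin flips, which on every instance of $\mathcal S$-MaxAgree with $n$ vertices outputs, with probability at least $\frac12$, a clustering within the factor $\rho(n)$ of the optimum. **Theorem.** Let $\alpha,\beta:\mathbb N\to\mathbb Q$ satisfy $\alpha(m),\beta(m)\ge 1$ and be computable in time polynomial in $m$, let $\lambda:\mathbb N\to[1,\infty)$ be monotone (nondecreasing or nonincreasing; for instance constant), and suppose that 1. $\alpha(m)+\beta(m)=O(m^{1/2-\delta})$ as $m\to\infty$,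 for some $\delta\in(0,\frac12]$, where $m$ is the number of vertices of the $\{-\alpha,0,\beta\}$-weighted graph; 2. $\{-\alpha(m),0,\beta(m)\}$-MaxAgree is approximable within the factor $\lambda(m)$ (which holds in particular if it has a deterministic polynomial-time $\lambda$-approximation algorithm), where $\lambda(m)=O(\log m)$. Then for every choice of $\mathcal S$ and every $\varepsilon>0$, $\mathcal S$-MaxAgree is approximable within the factor $\lambda(n)+\varepsilon$, that is, in randomized polynomial time with success probability at least $\frac12$ on every instance. -/

import Mathlib

namespace CorrClust

/-! Part 1. A programming language with a step count.

Data are binary trees whose leaves are natural numbers (written in binary). Programs are built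
from elementary operations by sequencing, pairing, branching and while loops. Costs are
logarithmic: an elementary operation pays for the total bit size of the data it reads and of the
data it writes. Hence a run of cost `t` can be carried out by a Turing machine in time polynomial
in `t`; conversely one step of a Turing machine (whose tape is a pair of stacks, i.e. nested
pairs) is a bounded number of operations, so polynomial cost is the usual polynomial time. -/

/-- Binary trees with natural numbers at the leaves. -/
inductive Data : Type
  | num (k : ℕ) : Data
  | pair (a b : Data) : Data

/-- The bit size of a datum; `Nat.size k` is the number of binary digits of `k`. -/
def Data.size : Data → ℕ
  | .num k => Nat.size k + 1
  | .pair a b => a.size + b.size + 1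

/-- Elementary operations. -/
inductive Op : Type
  | fst | snd | isNum | add | sub | mul | div | le

/-- The effect of an elementary operation. A binary operation expects a pair of numbers; on data
of the wrong shape the result is `0`. Subtraction is truncated, division is rounded down. -/
def Op.eval : Op → Data → Data
  | .fst, .pair a _ => a
  | .snd, .pair _ b => b
  | .isNum, .num _ => .num 1
  | .isNum, .pair _ _ => .num 0
  | .add, .pair (.num a) (.num b) => .num (a + b)
  | .sub, .pair (.num a) (.num b) => .num (a - b)
  | .mul, .pair (.num a) (.num b) => .num (a * b)
  | .div, .pair (.num a) (.num b) => .num (a / b)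
  | .le, .pair (.num a) (.num b) => .num (if a ≤ b then 1 else 0)
  | _, _ => .num 0

/-- Programs. Each program maps an input datum to an output datum. -/
inductive Code : Type
  | id : Code
  | const (d : Data) : Code
  | op (o : Op) : Code
  /-- run both programs on the input, and output the pair of the results -/
  | pair (f g : Code) : Code
  /-- first run `f`, then run `g` on the result -/
  | comp (g f : Code) : Code
  /-- run the test `c`; continue on the same input with `f` if the answer is not `0`,
  and with `g` if it is `0` -/
  | ite (c f g : Code) : Code
  /-- `while c ≠ 0 do x := f x` -/
  | loop (c f : Code) : Code

/-- `Runs c x y t`: on input `x` the program `c` halts with output `y`, at cost `t`. -/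
inductive Runs : Code → Data → Data → ℕ → Prop
  | id (x : Data) : Runs .id x x (x.size + 1)
  | const (d x : Data) : Runs (.const d) x d (x.size + d.size + 1)
  | op (o : Op) (x : Data) : Runs (.op o) x (o.eval x) (x.size + (o.eval x).size + 1)
  | pair {f g : Code} {x y z : Data} {s t : ℕ} :
      Runs f x y s → Runs g x z t → Runs (.pair f g) x (.pair y z) (s + t + 1)
  | comp {f g : Code} {x y z : Data} {s t : ℕ} :
      Runs f x y s → Runs g y z t → Runs (.comp g f) x z (s + t + 1)
  | ite_true {c f g : Code} {x v y : Data} {s t : ℕ} :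
      Runs c x v s → v ≠ .num 0 → Runs f x y t → Runs (.ite c f g) x y (s + t + 1)
  | ite_false {c f g : Code} {x y : Data} {s t : ℕ} :
      Runs c x (.num 0) s → Runs g x y t → Runs (.ite c f g) x y (s + t + 1)
  | loop_done {c f : Code} {x : Data} {s : ℕ} :
      Runs c x (.num 0) s → Runs (.loop c f) x x (s + 1)
  | loop_step {c f : Code} {x v y z : Data} {s t u : ℕ} :
      Runs c x v s → v ≠ .num 0 → Runs f x y t → Runs (.loop c f) y z u →
        Runs (.loop c f) x z (s + t + u + 1)

/-! Part 2. Encodings. -/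

/-- Lists as nested pairs. -/
def encList : List Data → Data
  | [] => .num 0
  | a :: l => .pair a (encList l)

/-- A rational number as (sign, (absolute value of the numerator, denominator)). -/
def encRat (q : ℚ) : Data :=
  .pair (.num (if q < 0 then 1 else 0)) (.pair (.num q.num.natAbs) (.num q.den))

/-- A string of coin flips. -/
def encCoins {k : ℕ} (r : Fin k → Bool) : Data :=
  encList (List.ofFn fun i => .num (r i).toNat)

/-- A labelling of the vertices. -/
def encLabels {n : ℕ} (c : Fin n → ℕ) : Data :=
  encList (List.ofFn fun i => .num (c i))

/-- The function `f` can be computed in time polynomial in its argument. -/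
def PolyTimeComputable (f : ℕ → ℚ) : Prop :=
  ∃ (c : Code) (p : Polynomial ℕ), ∀ m : ℕ, ∃ t ≤ p.eval m, Runs c (.num m) (encRat (f m)) t

/-! Part 3. Correlation clustering. -/

/-- An edge-weighted graph on the vertices `0, …, n - 1`. Positive weights are the weights of
edges labelled `+`, negative weights those of edges labelled `-`; non-edges have weight `0`. -/
structure WGraph (n : ℕ) where
  w : Fin n → Fin n → ℚ
  symm : ∀ i j, w i j = w j i
  loopless : ∀ i, w i i = 0

/-- All weights of pairs of distinct vertices are taken from `S n`: an instance of
`S`-MaxAgree. The set may depend on the number `n` of vertices. -/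
def WGraph.IsInstance {n : ℕ} (G : WGraph n) (S : ℕ → Set ℚ) : Prop :=
  ∀ i j, i ≠ j → G.w i j ∈ S n

open Classical in
/-- The weight of a clustering, i.e. of a partition of the vertices (given by its equivalence
relation): the total weight of the `+` edges inside clusters plus the total absolute weight of
the `-` edges across clusters. -/
noncomputable def WGraph.agree {n : ℕ} (G : WGraph n) (C : Setoid (Fin n)) : ℚ :=
  ∑ e : Fin n × Fin n with e.1 < e.2,
    if C.r e.1 e.2 then max (G.w e.1 e.2) 0 else max (-G.w e.1 e.2) 0

/-- The clustering `C` is within a factor `ρ` of every clustering. -/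
def WGraph.IsApprox {n : ℕ} (G : WGraph n) (ρ : ℝ) (C : Setoid (Fin n)) : Prop :=
  ∀ C' : Setoid (Fin n), (G.agree C' : ℝ) ≤ ρ * (G.agree C : ℝ)

/-- A graph is encoded by its number of vertices and its weight matrix. -/
def WGraph.enc {n : ℕ} (G : WGraph n) : Data :=
  .pair (.num n) (encList (List.ofFn fun i => encList (List.ofFn fun j => encRat (G.w i j))))

/-- On input `x` with coin flips `r`, the program outputs a labelling of the vertices whose
fibres form a clustering within a factor `ρ` of the optimum. -/
def Succeeds (A : Code) {n : ℕ} (G : WGraph n) (ρ : ℝ) {k : ℕ} (r : Fin k → Bool) : Prop :=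
  ∃ (c : Fin n → ℕ) (t : ℕ),
    Runs A (.pair G.enc (encCoins r)) (encLabels c) t ∧ G.IsApprox ρ (Setoid.ker c)

/-- There is a randomized polynomial-time algorithm that, with probability at least `1/2` over
polynomially many fair coin flips, approximates `S`-MaxAgree on graphs with `n` vertices within a
factor `ρ n`. The time bound holds for all outcomes of the coin flips. -/
def RandPolyTimeApprox (S : ℕ → Set ℚ) (ρ : ℕ → ℝ) : Prop :=
  ∃ (A : Code) (p q : Polynomial ℕ), ∀ (n : ℕ) (G : WGraph n), G.IsInstance S →
    (∀ r : Fin (q.eval G.enc.size) → Bool, ∃ (y : Data) (t : ℕ),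
      Runs A (.pair G.enc (encCoins r)) y t ∧ t ≤ p.eval G.enc.size) ∧
    (1 / 2 : ℝ) ≤
      (Nat.card {r : Fin (q.eval G.enc.size) → Bool // Succeeds A G (ρ n) r} : ℝ) /
        2 ^ (q.eval G.enc.size)

end CorrClust

/-! ### Bit sizes, costs of runs, and closure properties of polynomial time -/

namespace CorrClust

/-! A weighted pair can be imitated by a pseudorandom bipartite graph of proportional density. For a
prime `p` polynomial in `n`, each vertex `i` becomes a block of `p²` vertices with coordinates in
`F_p²`. The vertices `(i, x)` and `(j, y)` are joined, with weight `-α` or `β` according to the sign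
of `w i j`, when the residue `x₁y₁ + x₂ + y₂` lies below a threshold. The threshold makes the mean
absolute weight between the blocks equal to `|w i j| / total` up to rounding, so arbitrary weights
reduce to three values.

This graph behaves like a random one for all clusterings simultaneously. Rows with different `x₁`
are uncorrelated, so Cauchy-Schwarz (`discrepancy_sq_le`) bounds the deviation between two blocks by
about `√(g p⁷)`, where `g` is the edge weight; this is small against `p⁴` once `g` is small against
`p`. The blow-up has `m = n p²` vertices, so `m^(1/2-δ) ≤ n p^(1-2δ)`, and a large enough polynomial
`p` works (`exists_side_large`). Hence the value of a clustering of the blow-up is close to `spread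
/ total`.

A clustering of `G` lifts to one of spread `p⁴` times its value. Conversely, choose one
representative per block, with coordinates affine in the block index. These choices are pairwise
independent, so over all coefficients the average value of the induced clustering is `spread / p⁴`
(`sum_repLabels`). There are only `p⁴` choices and all are tried. The additive error is proportional
to `total`, which is at most twice the better of the two trivial clusterings, so it becomes a small
relative error.

The given algorithm guarantees `λ(m)` rather than `λ(n)`. Monotonicity closes this gap
(`exists_factor_bound`): either a trivial clustering already suffices, or `λ(m) ≤ λ(n) + ε/2` for
all but finitely many `n`, which are handled by a fixed table of clusterings. Everything is carried
out by explicit programs, whose cost is controlled through the predicate `PolyTime`. -/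

theorem _root_.Nat.size_add_le (a b : ℕ) : Nat.size (a + b) ≤ Nat.size a + Nat.size b + 1 := by
  rw [Nat.size_le]
  have ha := Nat.lt_size_self a
  have hb := Nat.lt_size_self b
  have h₁ : 2 ^ a.size ≤ 2 ^ (a.size + b.size) := Nat.pow_le_pow_right (by omega) (by omega)
  have h₂ : 2 ^ b.size ≤ 2 ^ (a.size + b.size) := Nat.pow_le_pow_right (by omega) (by omega)
  rw [pow_succ]
  omega

theorem _root_.Nat.size_mul_le (a b : ℕ) : Nat.size (a * b) ≤ Nat.size a + Nat.size b := by
  rw [Nat.size_le, pow_add]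
  exact Nat.mul_lt_mul'' (Nat.lt_size_self a) (Nat.lt_size_self b)

/-! ### Runs -/

theorem Data.one_le_size (d : Data) : 1 ≤ d.size := by
  cases d <;> simp [Data.size]

/-- Elementary operations pay for what they read and write. A time bound is therefore also a bound
on the output size, which is what makes polynomial time closed under composition. -/
theorem Runs.size_le {c : Code} {x y : Data} {t : ℕ} (h : Runs c x y t) :
    x.size ≤ t ∧ y.size ≤ t := by
  induction h <;> (try simp only [Data.size] at *) <;> omega

/-- A loop passing through the states `e 0, …, e k`. -/
theorem Runs.loop_of_states {c f : Code} {B k : ℕ} (e : ℕ → Data)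
    (htest : ∀ j < k, ∃ v t, t ≤ B ∧ v ≠ .num 0 ∧ Runs c (e j) v t)
    (hstep : ∀ j < k, ∃ t ≤ B, Runs f (e j) (e (j + 1)) t)
    (hend : ∃ t ≤ B, Runs c (e k) (.num 0) t) :
    ∃ t ≤ (k + 1) * (2 * B + 1), Runs (.loop c f) (e 0) (e k) t := by
  induction k generalizing e with
  | zero =>
    obtain ⟨t, ht, h⟩ := hend
    exact ⟨t + 1, by omega, .loop_done h⟩
  | succ k ih =>
    obtain ⟨u, hu, h⟩ := ih (fun j => e (j + 1)) (fun j hj => htest (j + 1) (by omega))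
      (fun j hj => hstep (j + 1) (by omega)) hend
    obtain ⟨v, s, hs, hv, h₁⟩ := htest 0 (by omega)
    obtain ⟨t, ht, h₂⟩ := hstep 0 (by omega)
    refine ⟨s + t + u + 1, ?_, .loop_step h₁ hv h₂ h⟩
    nlinarith

theorem _root_.Polynomial.eval_mono_nat (p : Polynomial ℕ) {a b : ℕ} (h : a ≤ b) :
    p.eval a ≤ p.eval b := by
  rw [Polynomial.eval_eq_sum_range, Polynomial.eval_eq_sum_range]
  gcongr

/-! ### Encodable types -/

/-- Types whose elements are represented by data. -/
class Enc (α : Type) where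
  enc : α → Data

open Enc

instance : Enc Data := ⟨fun d => d⟩
instance : Enc ℕ := ⟨.num⟩
instance : Enc Bool := ⟨fun b => .num b.toNat⟩

section

variable {α β γ σ : Type} [Enc α] [Enc β] [Enc γ] [Enc σ]

instance : Enc (α × β) := ⟨fun x => .pair (enc x.1) (enc x.2)⟩
instance : Enc (List α) := ⟨fun l => encList (l.map enc)⟩

/-- The size of the representation. -/
def sz (x : α) : ℕ := (enc x).size

theorem one_le_sz (x : α) : 1 ≤ sz x := Data.one_le_size _

theorem sz_nat (k : ℕ) : sz k = Nat.size k + 1 := rfl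

theorem sz_prod (x : α) (y : β) : sz (x, y) = sz x + sz y + 1 := rfl

theorem sz_nil : sz ([] : List α) = 1 := rfl

theorem sz_cons (a : α) (l : List α) : sz (a :: l) = sz a + sz l + 1 := rfl

theorem sz_append (l l' : List α) : sz (l ++ l') + 1 = sz l + sz l' := by
  induction l with
  | nil => simp [sz_nil]; omega
  | cons a l ih => rw [List.cons_append, sz_cons, sz_cons]; omega

theorem sz_reverse (l : List α) : sz l.reverse = sz l := by
  induction l with
  | nil => rfl
  | cons a l ih =>
    have := sz_append l.reverse [a]
    rw [List.reverse_cons, sz_cons]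
    rw [sz_cons, sz_nil] at this
    omega

theorem sz_le_of_prefix {l l' : List α} (h : l' <+: l) : sz l' ≤ sz l := by
  obtain ⟨m, rfl⟩ := h
  have := sz_append l' m
  have := one_le_sz m
  omega

theorem sz_le_of_mem {l : List α} {a : α} (h : a ∈ l) : sz a ≤ sz l := by
  induction l with
  | nil => simp at h
  | cons b l ih =>
    rw [sz_cons]
    rcases List.mem_cons.1 h with rfl | h
    · omega
    · have := ih h; omega

theorem length_le_sz (l : List α) : l.length ≤ sz l := by
  induction l with
  | nil => simp
  | cons b l ih => rw [sz_cons, List.length_cons]; omega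

theorem sz_list_le {l : List α} {B : ℕ} (h : ∀ a ∈ l, sz a ≤ B) :
    sz l ≤ l.length * (B + 1) + 1 := by
  induction l with
  | nil => simp [sz_nil]
  | cons b l ih =>
    have h₁ := ih fun a ha => h a (List.mem_cons_of_mem _ ha)
    have h₂ := h b List.mem_cons_self
    rw [sz_cons, List.length_cons]
    nlinarith

/-! ### Polynomially bounded functions -/

/-- `f x` is bounded by a polynomial in the size of `x`. -/
def PolyBounded (f : α → ℕ) : Prop := ∃ p : Polynomial ℕ, ∀ x, f x ≤ p.eval (sz x)

namespace PolyBounded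

theorem mono {f g : α → ℕ} (hg : PolyBounded g) (h : ∀ x, f x ≤ g x) : PolyBounded f :=
  hg.imp fun _ hp x => (h x).trans (hp x)

theorem const (k : ℕ) : PolyBounded fun _ : α => k := ⟨.C k, by simp⟩

theorem sz : PolyBounded fun x : α => sz x := ⟨.X, by simp⟩

theorem add {f g : α → ℕ} (hf : PolyBounded f) (hg : PolyBounded g) :
    PolyBounded fun x => f x + g x := by
  obtain ⟨p, hp⟩ := hf
  obtain ⟨q, hq⟩ := hg
  exact ⟨p + q, fun x => by simpa using add_le_add (hp x) (hq x)⟩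

theorem mul {f g : α → ℕ} (hf : PolyBounded f) (hg : PolyBounded g) :
    PolyBounded fun x => f x * g x := by
  obtain ⟨p, hp⟩ := hf
  obtain ⟨q, hq⟩ := hg
  exact ⟨p * q, fun x => by simpa using Nat.mul_le_mul (hp x) (hq x)⟩

theorem eval (p : Polynomial ℕ) {f : α → ℕ} (hf : PolyBounded f) :
    PolyBounded fun x => p.eval (f x) := by
  obtain ⟨q, hq⟩ := hf
  exact ⟨p.comp q, fun x => by simpa using p.eval_mono_nat (hq x)⟩

theorem pow {f : α → ℕ} (hf : PolyBounded f) (k : ℕ) : PolyBounded fun x => f x ^ k :=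
  (hf.eval (.X ^ k)).mono fun x => by simp

theorem comp {f : β → ℕ} {g : α → β} (hf : PolyBounded f)
    (hg : PolyBounded fun x => CorrClust.sz (g x)) : PolyBounded fun x => f (g x) := by
  obtain ⟨p, hp⟩ := hf
  exact (hg.eval p).mono fun x => hp _

theorem fst {f : α → ℕ} (hf : PolyBounded f) : PolyBounded fun x : α × β => f x.1 :=
  hf.comp (sz.mono fun x => by rw [sz_prod x.1 x.2]; omega)

theorem length : PolyBounded fun l : List α => l.length := sz.mono length_le_sz

end PolyBounded

/-! ### Polynomial time functions -/

/-- `f` is computed by a program in time polynomial in the size of the input. -/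
@[fun_prop]
def PolyTime (f : α → β) : Prop :=
  ∃ (c : Code) (p : Polynomial ℕ), ∀ x, ∃ t ≤ p.eval (sz x), Runs c (enc x) (enc (f x)) t

namespace PolyTime

theorem of_polyBounded {f : α → β} (c : Code) {T : α → ℕ} (hT : PolyBounded T)
    (h : ∀ x, ∃ t ≤ T x, Runs c (enc x) (enc (f x)) t) : PolyTime f := by
  obtain ⟨p, hp⟩ := hT
  refine ⟨c, p, fun x => ?_⟩
  obtain ⟨t, ht, h⟩ := h x
  exact ⟨t, ht.trans (hp x), h⟩

theorem size_polyBounded {f : α → β} (hf : PolyTime f) : PolyBounded fun x => sz (f x) := by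
  obtain ⟨c, p, h⟩ := hf
  refine ⟨p, fun x => ?_⟩
  obtain ⟨t, ht, h⟩ := h x
  exact h.size_le.2.trans ht

theorem _root_.CorrClust.PolyBounded.comp_polyTime {f : β → ℕ} {g : α → β} (hf : PolyBounded f)
    (hg : PolyTime g) : PolyBounded fun x => f (g x) :=
  hf.comp hg.size_polyBounded

@[fun_prop]
theorem id : PolyTime fun x : α => x :=
  .of_polyBounded .id (PolyBounded.sz.add (.const 1)) fun _ => ⟨_, le_rfl, .id _⟩

@[fun_prop]
theorem const (b : β) : PolyTime fun _ : α => b :=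
  .of_polyBounded (.const (enc b)) ((PolyBounded.sz.add (.const (sz b))).add (.const 1))
    fun _ => ⟨_, le_rfl, .const _ _⟩

@[fun_prop]
theorem comp {f : β → γ} {g : α → β} (hf : PolyTime f) (hg : PolyTime g) :
    PolyTime fun x => f (g x) := by
  have hb := hg.size_polyBounded
  obtain ⟨c, p, hc⟩ := hf
  obtain ⟨d, q, hd⟩ := hg
  refine .of_polyBounded (.comp c d)
    (((PolyBounded.sz.eval q).add (hb.eval p)).add (.const 1)) fun x => ?_
  obtain ⟨s, hs, h₁⟩ := hd x
  obtain ⟨t, ht, h₂⟩ := hc (g x)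
  exact ⟨s + t + 1, by omega, .comp h₁ h₂⟩

@[fun_prop]
theorem prodMk {f : α → β} {g : α → γ} (hf : PolyTime f) (hg : PolyTime g) :
    PolyTime fun x => (f x, g x) := by
  obtain ⟨c, p, hc⟩ := hf
  obtain ⟨d, q, hd⟩ := hg
  refine .of_polyBounded (.pair c d)
    (((PolyBounded.sz.eval p).add (PolyBounded.sz.eval q)).add (.const 1)) fun x => ?_
  obtain ⟨s, hs, h₁⟩ := hc x
  obtain ⟨t, ht, h₂⟩ := hd x
  exact ⟨s + t + 1, by omega, .pair h₁ h₂⟩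

theorem op (o : Op) : PolyTime o.eval := by
  have hsize : ∀ x : Data, (o.eval x).size ≤ 2 * x.size + 1 := by
    intro x
    unfold Op.eval
    split <;> simp only [Data.size]
    case h_5 a b =>
      have := Nat.size_add_le a b
      omega
    case h_6 a b =>
      have := Nat.size_le_size (Nat.sub_le a b)
      omega
    case h_7 a b =>
      have := Nat.size_mul_le a b
      omega
    case h_8 a b =>
      have := Nat.size_le_size (Nat.div_le_self a b)
      omega
    all_goals have h₁ : Nat.size 1 = 1 := Nat.size_one
    all_goals have h₀ : Nat.size 0 = 0 := Nat.size_zero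
    all_goals try split
    all_goals omega
  refine .of_polyBounded (.op o) (((PolyBounded.const 3).mul PolyBounded.sz).add (.const 2))
    fun x => ⟨_, ?_, .op o _⟩
  have := hsize x
  change x.size + (o.eval x).size + 1 ≤ 3 * x.size + 2
  omega

/-- Programs see only encodings, so a function may be replaced by any other with the same encoded
values. -/
theorem of_enc {f : α → β} {g : α → Data} (hg : PolyTime g) (h : ∀ x, enc (f x) = g x) :
    PolyTime f := by
  obtain ⟨c, p, hc⟩ := hg
  refine ⟨c, p, fun x => ?_⟩
  rw [h]
  exact hc x

theorem encode : PolyTime (enc : α → Data) := by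
  obtain ⟨c, p, hc⟩ := PolyTime.id (α := α)
  exact ⟨c, p, hc⟩

theorem of_op (o : Op) {f : α → β} (h : ∀ x, o.eval (enc x) = enc (f x)) : PolyTime f :=
  .of_enc ((PolyTime.op o).comp .encode) fun x => (h x).symm

theorem fst' : PolyTime fun x : α × β => x.1 := .of_op .fst fun _ => rfl
theorem snd' : PolyTime fun x : α × β => x.2 := .of_op .snd fun _ => rfl

@[fun_prop]
theorem fst {f : α → β × γ} (hf : PolyTime f) : PolyTime fun x => (f x).1 := fst'.comp hf

@[fun_prop]
theorem snd {f : α → β × γ} (hf : PolyTime f) : PolyTime fun x => (f x).2 := snd'.comp hf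

@[fun_prop]
theorem add {f g : α → ℕ} (hf : PolyTime f) (hg : PolyTime g) : PolyTime fun x => f x + g x :=
  (of_op (f := fun x : ℕ × ℕ => x.1 + x.2) .add fun _ => rfl).comp (hf.prodMk hg)

@[fun_prop]
theorem sub {f g : α → ℕ} (hf : PolyTime f) (hg : PolyTime g) : PolyTime fun x => f x - g x :=
  (of_op (f := fun x : ℕ × ℕ => x.1 - x.2) .sub fun _ => rfl).comp (hf.prodMk hg)

@[fun_prop]
theorem mul {f g : α → ℕ} (hf : PolyTime f) (hg : PolyTime g) : PolyTime fun x => f x * g x :=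
  (of_op (f := fun x : ℕ × ℕ => x.1 * x.2) .mul fun _ => rfl).comp (hf.prodMk hg)

@[fun_prop]
theorem div {f g : α → ℕ} (hf : PolyTime f) (hg : PolyTime g) : PolyTime fun x => f x / g x :=
  (of_op (f := fun x : ℕ × ℕ => x.1 / x.2) .div fun _ => rfl).comp (hf.prodMk hg)

@[fun_prop]
theorem mod {f g : α → ℕ} (hf : PolyTime f) (hg : PolyTime g) : PolyTime fun x => f x % g x := by
  simp_rw [Nat.mod_eq_sub_mul_div]
  fun_prop

@[fun_prop]
theorem ble {f g : α → ℕ} (hf : PolyTime f) (hg : PolyTime g) :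
    PolyTime fun x => Nat.ble (f x) (g x) := by
  refine (of_op (f := fun x : ℕ × ℕ => Nat.ble x.1 x.2) .le fun x => ?_).comp (hf.prodMk hg)
  change Data.num (if x.1 ≤ x.2 then 1 else 0) = .num (Nat.ble x.1 x.2).toNat
  by_cases h : x.1 ≤ x.2
  · rw [if_pos h, show Nat.ble x.1 x.2 = true by simpa using h]; rfl
  · rw [if_neg h, show Nat.ble x.1 x.2 = false by simpa [Nat.ble_eq, ← Bool.not_eq_true] using h]; rfl

@[fun_prop]
theorem cond {b : α → Bool} {f g : α → β} (hb : PolyTime b) (hf : PolyTime f) (hg : PolyTime g) :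
    PolyTime fun x => bif b x then f x else g x := by
  obtain ⟨a, o, ha⟩ := hb
  obtain ⟨c, p, hc⟩ := hf
  obtain ⟨d, q, hd⟩ := hg
  refine .of_polyBounded (.ite a c d) ((((PolyBounded.sz.eval o).add (PolyBounded.sz.eval p)).add
    (PolyBounded.sz.eval q)).add (.const 1)) fun x => ?_
  obtain ⟨r, hr, h₀⟩ := ha x
  obtain ⟨s, hs, h₁⟩ := hc x
  obtain ⟨t, ht, h₂⟩ := hd x
  cases hx : b x
  · rw [hx] at h₀
    exact ⟨r + t + 1, by omega, .ite_false h₀ h₂⟩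
  · rw [hx] at h₀
    exact ⟨r + s + 1, by omega, .ite_true h₀ (by simp [enc]) h₁⟩

@[fun_prop]
theorem not {b : α → Bool} (hb : PolyTime b) : PolyTime fun x => !b x := by
  have : (fun x => !b x) = fun x => bif b x then false else true := by
    funext x; cases b x <;> rfl
  rw [this]; fun_prop

@[fun_prop]
theorem and {b c : α → Bool} (hb : PolyTime b) (hc : PolyTime c) : PolyTime fun x => b x && c x := by
  have : (fun x => b x && c x) = fun x => bif b x then c x else false := by
    funext x; cases b x <;> rfl
  rw [this]; fun_prop

@[fun_prop]
theorem beq {f g : α → ℕ} (hf : PolyTime f) (hg : PolyTime g) :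
    PolyTime fun x => Nat.beq (f x) (g x) := by
  have : (fun x => Nat.beq (f x) (g x)) = fun x => Nat.ble (f x) (g x) && Nat.ble (g x) (f x) := by
    funext x
    rw [Bool.eq_iff_iff]
    rw [Nat.beq_eq, Bool.and_eq_true, Nat.ble_eq, Nat.ble_eq, le_antisymm_iff]
  rw [this]; fun_prop

@[fun_prop]
theorem blt {f g : α → ℕ} (hf : PolyTime f) (hg : PolyTime g) :
    PolyTime fun x => Nat.blt (f x) (g x) := by
  have : (fun x => Nat.blt (f x) (g x)) = fun x => Nat.ble (f x + 1) (g x) := rfl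
  rw [this]; fun_prop

@[fun_prop]
theorem pow {f : α → ℕ} (hf : PolyTime f) (k : ℕ) : PolyTime fun x => f x ^ k := by
  induction k with
  | zero => simpa using const 1
  | succ k ih => simp_rw [pow_succ]; fun_prop

theorem eval (p : Polynomial ℕ) {f : α → ℕ} (hf : PolyTime f) :
    PolyTime fun x => p.eval (f x) := by
  induction p using Polynomial.induction_on' with
  | add p q hp hq => simp only [Polynomial.eval_add]; fun_prop
  | monomial k a => simp only [Polynomial.eval_monomial]; fun_prop

@[fun_prop]
theorem cons {f : α → β} {g : α → List β} (hf : PolyTime f) (hg : PolyTime g) :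
    PolyTime fun x => f x :: g x :=
  .of_enc (encode.comp (hf.prodMk hg)) fun _ => rfl

/-- While loops, with explicit bounds on the number of iterations and on the states. -/
theorem iterate {init : α → σ} {f : σ → σ} {c : σ → Bool} {k : α → ℕ} (hinit : PolyTime init)
    (hc : PolyTime c)
    (hf : ∃ (d : Code) (p : Polynomial ℕ), ∀ s, c s = true →
      ∃ t ≤ p.eval (sz s), Runs d (enc s) (enc (f s)) t)
    (hk : PolyBounded k) (htrue : ∀ x, ∀ j < k x, c (f^[j] (init x)) = true)
    (hfalse : ∀ x, c (f^[k x] (init x)) = false) {B : α → ℕ} (hB : PolyBounded B)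
    (hsz : ∀ x, ∀ j ≤ k x, sz (f^[j] (init x)) ≤ B x) :
    PolyTime fun x => f^[k x] (init x) := by
  obtain ⟨i, o, hi⟩ := hinit
  obtain ⟨a, p, ha⟩ := hc
  obtain ⟨d, q, hd⟩ := hf
  refine .of_polyBounded (.comp (.loop a d) i) (((PolyBounded.sz.eval o).add
    ((hk.add (.const 1)).mul (((PolyBounded.const 2).mul
      ((hB.eval p).add (hB.eval q))).add (.const 1)))).add (.const 1)) fun x => ?_
  obtain ⟨r, hr, h₀⟩ := hi x
  suffices ∃ s ≤ (k x + 1) * (2 * (p.eval (B x) + q.eval (B x)) + 1),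
      Runs (.loop a d) (enc (init x)) (enc (f^[k x] (init x))) s by
    obtain ⟨s, hs, h₁⟩ := this
    exact ⟨r + s + 1, by omega, .comp h₀ h₁⟩
  refine Runs.loop_of_states (fun j => enc (f^[j] (init x))) (fun j hj => ?_) (fun j hj => ?_) ?_
  · obtain ⟨t, ht, h⟩ := ha (f^[j] (init x))
    rw [htrue x j hj] at h
    exact ⟨_, t, (ht.trans (p.eval_mono_nat (hsz x j hj.le))).trans (by omega), by simp [enc], h⟩
  · obtain ⟨t, ht, h⟩ := hd _ (htrue x j hj)
    rw [← Function.iterate_succ_apply' f] at h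
    exact ⟨t, (ht.trans (q.eval_mono_nat (hsz x j hj.le))).trans (by omega), h⟩
  · obtain ⟨t, ht, h⟩ := ha (f^[k x] (init x))
    rw [hfalse x] at h
    exact ⟨t, (ht.trans (p.eval_mono_nat (hsz x _ le_rfl))).trans (by omega), h⟩

end PolyTime

end

end CorrClust

/-! ### Polynomial-time list processing -/

namespace CorrClust

open Enc

section

variable {α β γ σ : Type} [Enc α] [Enc β] [Enc γ] [Enc σ]

namespace PolyTime

theorem isEmpty : PolyTime fun l : List α => l.isEmpty :=
  of_op .isNum fun l => by cases l <;> rfl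

/-- One step of a fold. -/
def foldStep (step : α → σ → β → σ) (s : α × List β × σ) : α × List β × σ :=
  match s.2.1 with
  | [] => s
  | b :: l => (s.1, l, step s.1 s.2.2 b)

omit [Enc α] [Enc β] [Enc σ] in
theorem foldStep_iterate (step : α → σ → β → σ) (x : α) (l : List β) (s : σ) {j : ℕ}
    (hj : j ≤ l.length) :
    (foldStep step)^[j] (x, l, s) = (x, l.drop j, (l.take j).foldl (step x) s) := by
  induction j generalizing l s with
  | zero => simp
  | succ j ih =>
    cases l with
    | nil => simp at hj
    | cons b l =>
      rw [Function.iterate_succ_apply]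
      exact ih l _ (by simpa using hj)

/-- A polynomial-time step iterated polynomially often may still produce huge data, as repeated
squaring does. Hence the separate bound on the accumulator along every prefix. -/
theorem foldl {l : α → List β} {init : α → σ} {step : α → σ → β → σ} (hl : PolyTime l)
    (hinit : PolyTime init) (hstep : PolyTime fun y : α × σ × β => step y.1 y.2.1 y.2.2)
    {B : α → ℕ} (hB : PolyBounded B)
    (hsz : ∀ x l', l' <+: l x → sz (l'.foldl (step x) (init x)) ≤ B x) :
    PolyTime fun x => (l x).foldl (step x) (init x) := by
  have key : PolyTime fun x => (foldStep step)^[(l x).length] (x, l x, init x) := by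
    refine iterate (c := fun s => !s.2.1.isEmpty) (by fun_prop) ?_ ?_
      (hl.size_polyBounded.mono fun x => length_le_sz _) ?_ ?_
      (((PolyBounded.sz.add hl.size_polyBounded).add hB).add (.const 2)) ?_
    · exact (isEmpty.comp (by fun_prop)).not
    · obtain ⟨c, p, hc⟩ := hstep
      -- A nonempty list has the same encoding as the pair of its head and tail, so the step is
      -- programmed on `β × List β` and then applied to `b :: l`. The empty list is excluded by the
      -- loop test.
      have hpre : PolyTime fun y : α × (β × List β) × σ => ((y.1, y.2.2, y.2.1.1), y.1, y.2.1.2) := by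
        fun_prop
      have hpost : PolyTime fun y : σ × α × List β => (y.2.1, y.2.2, y.1) := by fun_prop
      have hmid : PolyTime fun y : (α × σ × β) × α × List β =>
          (step y.1.1 y.1.2.1 y.1.2.2, y.2) :=
        .prodMk (comp (f := fun y : α × σ × β => step y.1 y.2.1 y.2.2) ⟨c, p, hc⟩ (by fun_prop))
          (by fun_prop)
      obtain ⟨d, q, hd⟩ := hpost.comp (hmid.comp hpre)
      refine ⟨d, q, fun s hs => ?_⟩
      obtain ⟨x, l, s⟩ := s
      cases l with
      | nil => simp at hs
      | cons b l => exact hd (x, (b, l), s)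
    · intro x j hj
      rw [foldStep_iterate _ _ _ _ hj.le]
      simpa using hj
    · intro x
      rw [foldStep_iterate _ _ _ _ le_rfl]
      simp
    · intro x j hj
      rw [foldStep_iterate _ _ _ _ hj, sz_prod, sz_prod]
      have h₁ := hsz x _ (List.take_prefix j (l x))
      have h₂ := sz_append ((l x).take j) ((l x).drop j)
      rw [List.take_append_drop] at h₂
      have h₃ := one_le_sz ((l x).take j)
      omega
  have : (fun x => (l x).foldl (step x) (init x)) =
      fun x => ((foldStep step)^[(l x).length] (x, l x, init x)).2.2 := by
    funext x
    rw [foldStep_iterate _ _ _ _ le_rfl, List.take_length]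
  rw [this]
  exact key.snd.snd

@[fun_prop]
theorem reverse {l : α → List β} (hl : PolyTime l) : PolyTime fun x => (l x).reverse := by
  have : (fun x => (l x).reverse) = fun x => (l x).foldl (fun s b => b :: s) [] := by
    funext x; simp
  rw [this]
  refine foldl hl (const _) (by fun_prop) hl.size_polyBounded fun x l' h => ?_
  have := sz_le_of_prefix h
  simpa [sz_reverse] using this

omit [Enc σ] in
theorem sz_map_le (f : σ → γ) {l : List σ} {B : ℕ} (h : ∀ b ∈ l, sz (f b) ≤ B) :
    sz (l.map f) ≤ l.length * (B + 1) + 1 := by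
  simpa using sz_list_le (l := l.map f) (B := B) (by simpa using h)

theorem comp₂ {f : β → γ → σ} {g : α → β} {h : α → γ} (hf : PolyTime fun y : β × γ => f y.1 y.2)
    (hg : PolyTime g) (hh : PolyTime h) : PolyTime fun x => f (g x) (h x) :=
  comp (f := fun y : β × γ => f y.1 y.2) hf (hg.prodMk hh)

theorem map {l : α → List β} {f : α → β → γ} (hl : PolyTime l)
    (hf : PolyTime fun y : α × β => f y.1 y.2) : PolyTime fun x => (l x).map (f x) := by
  have : (fun x => (l x).map (f x)) = fun x =>
      ((l x).foldl (fun s b => f x b :: s) []).reverse := by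
    funext x
    simp
  rw [this]
  obtain ⟨p, hp⟩ := hf.size_polyBounded
  refine (foldl (B := fun x => sz (l x) * (p.eval (sz x + sz (l x) + 1) + 1) + 1)
    (step := fun x s b => f x b :: s) hl (const _) ?_ ?_ fun x l' h => ?_).reverse
  · exact (hf.comp₂ (by fun_prop) (by fun_prop)).cons (by fun_prop)
  · have := hl.size_polyBounded
    exact ((this.mul ((((PolyBounded.sz.add this).add (.const 1)).eval p).add (.const 1)))).add
      (.const 1)
  · have h₁ : l'.foldl (fun s b => f x b :: s) [] = (l'.map (f x)).reverse := by simp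
    rw [h₁, sz_reverse]
    refine (sz_map_le (f x) (B := p.eval (sz x + sz (l x) + 1)) fun b hb => ?_).trans ?_
    · refine (hp (x, b)).trans (p.eval_mono_nat ?_)
      rw [sz_prod]
      have := sz_le_of_mem hb
      have := sz_le_of_prefix h
      omega
    · gcongr
      exact (length_le_sz l').trans (sz_le_of_prefix h)

theorem sz_sum_le (l : List ℕ) : sz l.sum ≤ sz l + 1 := by
  induction l with
  | nil => simp [sz_nil, sz_nat]
  | cons a l ih =>
    have := Nat.size_add_le a l.sum
    rw [List.sum_cons, sz_cons]
    simp only [sz_nat] at *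
    omega

@[fun_prop]
theorem sum {l : α → List ℕ} (hl : PolyTime l) : PolyTime fun x => (l x).sum := by
  have : (fun x => (l x).sum) = fun x => (l x).foldl (fun s b => s + b) 0 := by
    funext x; exact List.sum_eq_foldl
  rw [this]
  refine foldl hl (const _) (by fun_prop) (hl.size_polyBounded.add (.const 1)) fun x l' h => ?_
  rw [← List.sum_eq_foldl]
  have := sz_sum_le l'
  have := sz_le_of_prefix h
  omega

theorem sz_prod_le (l : List ℕ) : sz l.prod ≤ sz l + 1 := by
  induction l with
  | nil => simp [sz_nil, sz_nat]
  | cons a l ih =>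
    have := Nat.size_mul_le a l.prod
    rw [List.prod_cons, sz_cons]
    simp only [sz_nat] at *
    omega

@[fun_prop]
theorem prod {l : α → List ℕ} (hl : PolyTime l) : PolyTime fun x => (l x).prod := by
  have : (fun x => (l x).prod) = fun x => (l x).foldl (fun s b => s * b) 1 := by
    funext x; exact List.prod_eq_foldl
  rw [this]
  refine foldl hl (const _) (by fun_prop) (hl.size_polyBounded.add (.const 1)) fun x l' h => ?_
  rw [← List.prod_eq_foldl]
  have := sz_prod_le l'
  have := sz_le_of_prefix h
  omega

@[fun_prop]
theorem length {l : α → List β} (hl : PolyTime l) : PolyTime fun x => (l x).length := by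
  have : (fun x => (l x).length) = fun x => ((l x).map fun _ => 1).sum := by
    funext x; simp
  rw [this]
  exact (map hl (const 1)).sum

omit [Enc β] in
/-- The value at index `i`, by a single pass through the list. -/
theorem getD_eq_foldl (l : List β) (i : ℕ) (d : β) :
    (l.foldl (fun s b => (s.1 - 1, bif Nat.beq s.1 1 then b else s.2)) (i + 1, d)).2 =
      l.getD i d := by
  -- The counter starts at `i + 1` and selects when it equals `1`. By truncated subtraction it then
  -- stays at `0`, so the selected value is never overwritten.
  have h₀ : ∀ (l : List β) (b : β),
      (l.foldl (fun s b => (s.1 - 1, bif Nat.beq s.1 1 then b else s.2)) (0, b)).2 = b := by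
    intro l
    induction l with
    | nil => simp
    | cons c l ih => intro b; exact ih b
  induction l generalizing i with
  | nil => simp
  | cons b l ih =>
    cases i with
    | zero => simpa using h₀ l b
    | succ i => exact ih i

@[fun_prop]
theorem getD {l : α → List β} {i : α → ℕ} {d : α → β} (hl : PolyTime l) (hi : PolyTime i)
    (hd : PolyTime d) : PolyTime fun x => (l x).getD (i x) (d x) := by
  simp_rw [← getD_eq_foldl]
  refine (foldl (step := fun _ (s : ℕ × β) b => (s.1 - 1, bif Nat.beq s.1 1 then b else s.2))
    (init := fun x => (i x + 1, d x)) hl (by fun_prop) (by fun_prop)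
    (B := fun x => sz (i x + 1) + sz (l x) + sz (d x) + 1) ?_ ?_).snd
  · exact (((PolyTime.size_polyBounded (f := fun x => i x + 1) (by fun_prop)).add
      hl.size_polyBounded).add hd.size_polyBounded).add (.const 1)
  · intro x l' h
    have key : ∀ (l' : List β) (s : ℕ × β) (A B : ℕ), sz s.1 ≤ A → sz s.2 ≤ B →
        (∀ b ∈ l', sz b ≤ B) →
        sz (l'.foldl (fun s b => (s.1 - 1, bif Nat.beq s.1 1 then b else s.2)) s) ≤ A + B + 1 := by
      intro l'
      induction l' with
      | nil => intro s A B h₁ h₂ _; simp only [List.foldl_nil]; rw [sz_prod s.1 s.2]; omega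
      | cons b l' ih =>
        intro s A B h₁ h₂ h₃
        refine ih _ A B (le_trans ?_ h₁) ?_ fun c hc => h₃ c (List.mem_cons_of_mem _ hc)
        · exact Nat.add_le_add_right (Nat.size_le_size (Nat.sub_le _ _)) 1
        · dsimp only
          cases Nat.beq s.1 1
          · exact h₂
          · exact h₃ b List.mem_cons_self
    refine (key l' _ (sz (i x + 1)) (sz (l x) + sz (d x)) le_rfl (by simp) fun b hb => ?_).trans
      (by omega)
    exact ((sz_le_of_mem hb).trans (sz_le_of_prefix h)).trans (by omega)

theorem sz_le_of_le {a b : ℕ} (h : a ≤ b) : sz a ≤ sz b :=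
  Nat.add_le_add_right (Nat.size_le_size h) 1

theorem sz_nat_le (a : ℕ) : sz a ≤ a + 1 :=
  Nat.add_le_add_right (Nat.size_le.2 Nat.lt_two_pow_self) 1

theorem sz_range_le (n : ℕ) : sz (List.range n) ≤ n * (n + 2) + 1 := by
  refine (sz_list_le (B := n + 1) fun a ha => ?_).trans (by simp)
  exact (sz_nat_le a).trans (by have := List.mem_range.1 ha; omega)

/-- Numbers are written in binary, so `range n` can be exponentially longer than `n`; its value, not
only its size, must be polynomially bounded. -/
theorem range {n : α → ℕ} (hn : PolyTime n) (hb : PolyBounded n) :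
    PolyTime fun x => List.range (n x) := by
  let f : (ℕ × List ℕ) → ℕ × List ℕ := fun s => (s.1 - 1, (s.1 - 1) :: s.2)
  have hf : ∀ m j, j ≤ m → f^[j] (m, []) = (m - j, (List.range m).drop (m - j)) := by
    intro m j hj
    induction j with
    | zero => simp
    | succ j ih =>
      rw [Function.iterate_succ_apply', ih (by omega)]
      refine Prod.ext (by simp [f]; omega) ?_
      rw [List.drop_eq_getElem_cons (by simp; omega : m - (j + 1) < _)]
      simp only [f, List.getElem_range]
      rw [show m - (j + 1) + 1 = m - j by omega]
      simp [Nat.sub_sub]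
  have : (fun x => List.range (n x)) = fun x => (f^[n x] (n x, [])).2 := by
    funext x; rw [hf _ _ le_rfl]; simp
  rw [this]
  refine (iterate (init := fun x => (n x, ([] : List ℕ))) (c := fun s => Nat.blt 0 s.1) (f := f)
    (by fun_prop) (by fun_prop)
    ?_ hb ?_ ?_ (B := fun x => (n x + 1) + (n x * (n x + 2) + 1) + 1) ?_ ?_).snd
  · obtain ⟨d, p, h⟩ : PolyTime f := by fun_prop
    exact ⟨d, p, fun s _ => h s⟩
  · intro x j hj
    rw [hf _ _ hj.le]
    exact Nat.ble_eq.mpr (by simp only; omega)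
  · intro x
    rw [hf _ _ le_rfl]
    rw [Nat.sub_self]
    rfl
  · exact ((hb.add (.const 1)).add ((hb.mul (hb.add (.const 2))).add (.const 1))).add (.const 1)
  · intro x j hj
    rw [hf _ _ hj, sz_prod]
    have h₁ := (sz_nat_le (n x - j))
    have h₂ := sz_append ((List.range (n x)).take (n x - j)) ((List.range (n x)).drop (n x - j))
    rw [List.take_append_drop] at h₂
    have := one_le_sz ((List.range (n x)).take (n x - j))
    have := sz_range_le (n x)
    omega

/-- Comprehensions over an initial segment of the natural numbers. -/
theorem mapRange {n : α → ℕ} {f : α → ℕ → γ} (hn : PolyTime n) (hb : PolyBounded n)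
    (hf : PolyTime fun y : α × ℕ => f y.1 y.2) : PolyTime fun x => (List.range (n x)).map (f x) :=
  map (range hn hb) hf

end PolyTime

/-- An element of the list `d :: l` with the greatest value of `f`. -/
def best (f : β → ℕ) (d : β) (l : List β) : β :=
  l.foldl (fun s b => bif Nat.blt (f s) (f b) then b else s) d

omit [Enc β] in
theorem best_mem (f : β → ℕ) (d : β) (l : List β) : best f d l ∈ d :: l := by
  induction l generalizing d with
  | nil => simp [best]
  | cons b l ih =>
    have := ih (bif Nat.blt (f d) (f b) then b else d)
    change best f _ l ∈ _
    cases h : Nat.blt (f d) (f b) <;> simp only [h, cond_true, cond_false] at this ⊢ <;>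
      simp only [List.mem_cons] at this ⊢ <;> tauto

omit [Enc β] in
theorem le_best (f : β → ℕ) (d : β) (l : List β) : ∀ b ∈ d :: l, f b ≤ f (best f d l) := by
  induction l generalizing d with
  | nil => simp [best]
  | cons b l ih =>
    have := ih (bif Nat.blt (f d) (f b) then b else d)
    change ∀ c ∈ d :: b :: l, f c ≤ f (best f _ l)
    cases h : Nat.blt (f d) (f b)
    · simp only [h, cond_false, List.forall_mem_cons] at this ⊢
      refine ⟨this.1, le_trans ?_ this.1, this.2⟩
      have : ¬ (f d < f b) := by rw [← Nat.blt_eq, h]; simp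
      omega
    · simp only [h, cond_true, List.forall_mem_cons] at this ⊢
      have h' : f d < f b := by rw [← Nat.blt_eq]; exact h
      exact ⟨h'.le.trans this.1, this⟩

theorem PolyTime.best {f : α → β → ℕ} {d : α → β} {l : α → List β}
    (hf : PolyTime fun y : α × β => f y.1 y.2) (hd : PolyTime d) (hl : PolyTime l) :
    PolyTime fun x => best (f x) (d x) (l x) := by
  refine foldl (step := fun x s b => bif Nat.blt (f x s) (f x b) then b else s) hl hd ?_
    (hd.size_polyBounded.add hl.size_polyBounded) fun x l' h => ?_
  · have h₁ : PolyTime fun y : α × β × β => f y.1 y.2.1 :=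
      hf.comp₂ (by fun_prop) (by fun_prop)
    have h₂ : PolyTime fun y : α × β × β => f y.1 y.2.2 :=
      hf.comp₂ (by fun_prop) (by fun_prop)
    fun_prop
  · have h₁ := best_mem (f x) (d x) l'
    have h₂ := sz_le_of_prefix h
    change sz (CorrClust.best (f x) (d x) l') ≤ _
    rcases List.mem_cons.1 h₁ with h₁ | h₁
    · rw [h₁]; omega
    · have := sz_le_of_mem h₁
      omega

end

end CorrClust

/-! ### The reduction as programs, with running times -/

namespace CorrClust

open Enc

/-- The data of a rational number. -/
abbrev Tri : Type := ℕ × ℕ × ℕ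

/-- The data of a weight matrix. -/
abbrev Mat : Type := List (List Tri)

/-- A rational number as a triple of natural numbers. -/
def ratTri (q : ℚ) : Tri := (if q < 0 then 1 else 0, q.num.natAbs, q.den)

/-- The weight matrix of a graph, as data. -/
def WGraph.mat {n : ℕ} (G : WGraph n) : Mat :=
  List.ofFn fun i => List.ofFn fun j => ratTri (G.w i j)

theorem enc_mat {n : ℕ} (G : WGraph n) : enc (n, G.mat) = G.enc := by
  simp only [enc, WGraph.mat, WGraph.enc, List.map_ofFn, Function.comp_def]
  rfl

/-! ### The programs -/

/-- The weight of the pair `i, j`. -/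
def entry (M : Mat) (i j : ℕ) : Tri := (M.getD i []).getD j (0, 0, 1)

/-- The product of all denominators. -/
def denProd (M : Mat) : ℕ := (M.map fun row => (row.map fun t => t.2.2).prod).prod

/-- The absolute weight of the pair `i, j`, scaled by `denProd M`. -/
def absWeight (M : Mat) (i j : ℕ) : ℕ := (entry M i j).2.1 * (denProd M / (entry M i j).2.2)

/-- The total scaled absolute weight of all ordered pairs. -/
def totalWeight (M : Mat) : ℕ :=
  ((List.range M.length).map fun i =>
    ((List.range M.length).map fun j => absWeight M i j).sum).sum

/-- The contribution of the pair `i, j` to the value of the clustering with labels `L`. -/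
def scoreAt (M : Mat) (L : List ℕ) (i j : ℕ) : ℕ :=
  bif Nat.beq (entry M i j).1 (bif Nat.beq (L.getD i 0) (L.getD j 0) then 0 else 1) then
    absWeight M i j else 0

/-- The scaled value (over ordered pairs) of the clustering with labels `L`. -/
def score (M : Mat) (L : List ℕ) : ℕ :=
  ((List.range M.length).map fun i =>
    ((List.range M.length).map fun j => scoreAt M L i j).sum).sum

/-- The number of `d < B` that are proper divisors of `p` other than `1`. -/
def divisorCount (B p : ℕ) : ℕ :=
  ((List.range B).map fun d =>
    bif Nat.blt 1 d && Nat.blt d p && Nat.beq (p % d) 0 then 1 else 0).sum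

/-- `p` if `p` has no nontrivial divisor below `B`. -/
def primeValue (B p : ℕ) : ℕ := bif Nat.beq (divisorCount B p) 0 then p else 0

/-- A prime number between `R` and `2 * R`. -/
def findPrime (R : ℕ) : ℕ := best (primeValue (2 * R + 1)) 0 (List.range (2 * R + 1))

/-- The side length of the blocks of the blow-up. -/
def side (K k n : ℕ) : ℕ := findPrime (K * (n + 1) ^ k)

/-- `⌊(a / W) (p / g)⌋` where `a` is the scaled absolute weight of the pair `i, j`. -/
def threshold (M : Mat) (p W : ℕ) (g : Tri) (i j : ℕ) : ℕ :=
  absWeight M i j * p * g.2.2 / (W * g.2.1)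

/-- The weights of the blow-up. -/
def blowEntry (M : Mat) (p W : ℕ) (a b : Tri) (u v : ℕ) : Tri :=
  bif Nat.blt (((u / p % p) * (v / p % p) + u % p + v % p) % p)
      (threshold M p W (bif Nat.beq (entry M (u / (p * p)) (v / (p * p))).1 1 then a else b)
        (u / (p * p)) (v / (p * p))) then
    bif Nat.beq (entry M (u / (p * p)) (v / (p * p))).1 1 then (1, a.2) else (0, b.2)
  else (0, 0, 1)

/-- The number of vertices of the blow-up. -/
def blowSize (K k n : ℕ) : ℕ := n * (side K k n * side K k n)

/-- The blow-up of a graph, in which every vertex becomes a block of `p * p` vertices. -/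
def blow (α β : ℕ → ℚ) (K k : ℕ) (M : Mat) : ℕ × Mat :=
  (blowSize K k M.length, (List.range (blowSize K k M.length)).map fun u =>
    (List.range (blowSize K k M.length)).map fun v =>
      blowEntry M (side K k M.length) (totalWeight M) (ratTri (α (blowSize K k M.length)))
        (ratTri (β (blowSize K k M.length))) u v)

/-- Read a datum as a number. -/
def toNum : Data → ℕ
  | .num k => k
  | .pair _ _ => 0

/-- Read a datum as a list of numbers. -/
def toLabels : Data → List ℕ
  | .num _ => []
  | .pair a b => toNum a :: toLabels b

/-- The labels of representatives of the `n` blocks. The representatives are given by the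
two affine functions whose coefficients are the digits of `q` in base `p`. -/
def candidate (n p : ℕ) (L : List ℕ) (q : ℕ) : List ℕ :=
  (List.range n).map fun i => L.getD (i * (p * p) +
    ((q % p + (q / p % p) * i) % p * p +
      (q / (p * p) % p + (q / (p * p * p) % p) * i) % p)) 0

/-- The best clustering among the trivial ones, those of a given list and the candidates. -/
def bestLabels (K k : ℕ) (brute : List (List ℕ)) (M : Mat) (L : List ℕ) : List ℕ :=
  best (score M) (best (score M) (List.range M.length) ([] :: brute))
    ((List.range (side K k M.length ^ 4)).map
      fun q => candidate M.length (side K k M.length) L q)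

/-- Make `L` a list of length `n`. -/
def normalize (n : ℕ) (L : List ℕ) : List ℕ := (List.range n).map fun i => L.getD i 0

/-! ### Running times -/

section

variable {δ : Type} [Enc δ]

namespace PolyTime

@[fun_prop]
theorem entry {M : δ → Mat} {i j : δ → ℕ} (hM : PolyTime M) (hi : PolyTime i) (hj : PolyTime j) :
    PolyTime fun x => entry (M x) (i x) (j x) := by
  unfold CorrClust.entry; fun_prop

@[fun_prop]
theorem denProd {M : δ → Mat} (hM : PolyTime M) : PolyTime fun x => denProd (M x) := by
  refine (map (f := fun _ (row : List Tri) => (row.map fun t => t.2.2).prod) hM ?_).prod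
  exact (map (f := fun _ (t : Tri) => t.2.2) (by fun_prop) (by fun_prop)).prod

@[fun_prop]
theorem absWeight {M : δ → Mat} {i j : δ → ℕ} (hM : PolyTime M) (hi : PolyTime i)
    (hj : PolyTime j) : PolyTime fun x => absWeight (M x) (i x) (j x) := by
  unfold CorrClust.absWeight; fun_prop

theorem length_polyBounded {α : Type} [Enc α] {l : δ → List α} (hl : PolyTime l) :
    PolyBounded fun x => (l x).length :=
  PolyBounded.length.comp_polyTime hl

/-- Double sums over the index pairs of a matrix. -/
theorem sumPairs {M : δ → Mat} {f : δ → ℕ → ℕ → ℕ} (hM : PolyTime M)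
    (hf : PolyTime fun y : (δ × ℕ) × ℕ => f y.1.1 y.1.2 y.2) :
    PolyTime fun x => ((List.range (M x).length).map fun i =>
      ((List.range (M x).length).map fun j => f x i j).sum).sum := by
  refine (mapRange (f := fun x i => ((List.range (M x).length).map fun j => f x i j).sum)
    hM.length hM.length_polyBounded ?_).sum
  have hM' : PolyTime fun y : δ × ℕ => M y.1 := by fun_prop
  exact (mapRange (f := fun (y : δ × ℕ) j => f y.1 y.2 j) hM'.length hM'.length_polyBounded hf).sum

@[fun_prop]
theorem totalWeight {M : δ → Mat} (hM : PolyTime M) : PolyTime fun x => totalWeight (M x) :=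
  sumPairs (f := fun x i j => CorrClust.absWeight (M x) i j) hM (by fun_prop)

@[fun_prop]
theorem score {M : δ → Mat} {L : δ → List ℕ} (hM : PolyTime M) (hL : PolyTime L) :
    PolyTime fun x => score (M x) (L x) := by
  refine sumPairs (f := fun x i j => scoreAt (M x) (L x) i j) hM ?_
  unfold scoreAt
  fun_prop

theorem findPrime {R : δ → ℕ} (hR : PolyTime R) (hb : PolyBounded R) :
    PolyTime fun x => findPrime (R x) := by
  have hb' : PolyBounded fun x => 2 * R x + 1 := ((PolyBounded.const 2).mul hb).add (.const 1)
  refine PolyTime.best (f := fun x p => primeValue (2 * R x + 1) p) ?_ (const 0)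
    (range (by fun_prop) hb')
  have : PolyTime fun y : δ × ℕ => divisorCount (2 * R y.1 + 1) y.2 :=
    (mapRange (n := fun y : δ × ℕ => 2 * R y.1 + 1)
      (f := fun y d => bif Nat.blt 1 d && Nat.blt d y.2 && Nat.beq (y.2 % d) 0 then 1 else 0)
      (by fun_prop) hb'.fst (by fun_prop)).sum
  unfold primeValue
  fun_prop

theorem _root_.CorrClust.findPrime_le (R : ℕ) : CorrClust.findPrime R ≤ 2 * R := by
  have := best_mem (primeValue (2 * R + 1)) 0 (List.range (2 * R + 1))
  rcases List.mem_cons.1 this with h | h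
  · rw [CorrClust.findPrime, h]; omega
  · rw [CorrClust.findPrime]
    have := List.mem_range.1 h
    omega

theorem side_polyBounded (K k : ℕ) {n : δ → ℕ} (hb : PolyBounded n) :
    PolyBounded fun x => side K k (n x) :=
  ((PolyBounded.const 2).mul ((PolyBounded.const K).mul ((hb.add (.const 1)).pow k))).mono
    fun _ => findPrime_le _

theorem side (K k : ℕ) {n : δ → ℕ} (hn : PolyTime n) (hb : PolyBounded n) :
    PolyTime fun x => side K k (n x) :=
  findPrime (by fun_prop) ((PolyBounded.const K).mul ((hb.add (.const 1)).pow k))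

@[fun_prop]
theorem blowEntry {M : δ → Mat} {p W : δ → ℕ} {a b : δ → Tri} {u v : δ → ℕ} (hM : PolyTime M)
    (hp : PolyTime p) (hW : PolyTime W) (ha : PolyTime a) (hb : PolyTime b) (hu : PolyTime u)
    (hv : PolyTime v) :
    PolyTime fun x => blowEntry (M x) (p x) (W x) (a x) (b x) (u x) (v x) := by
  unfold CorrClust.blowEntry threshold
  fun_prop

/-- The cost of computing `f` is polynomial in the value of its argument, not in its bit length;
hence the bound on `n x`. -/
theorem ratTri {f : ℕ → ℚ} (hf : PolyTimeComputable f) {n : δ → ℕ} (hn : PolyTime n)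
    (hb : PolyBounded n) : PolyTime fun x => ratTri (f (n x)) := by
  obtain ⟨c, p, hc⟩ := hf
  obtain ⟨d, q, hd⟩ := hn
  refine .of_polyBounded (.comp c d)
    (((PolyBounded.sz.eval q).add (hb.eval p)).add (.const 1)) fun x => ?_
  obtain ⟨s, hs, h₁⟩ := hd x
  obtain ⟨t, ht, h₂⟩ := hc (n x)
  exact ⟨s + t + 1, by omega, .comp h₁ h₂⟩

theorem blow {α β : ℕ → ℚ} (hα : PolyTimeComputable α) (hβ : PolyTimeComputable β) (K k : ℕ)
    {M : δ → Mat} (hM : PolyTime M) : PolyTime fun x => blow α β K k (M x) := by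
  have hn := hM.length
  have hb := hM.length_polyBounded
  have hp := side K k hn hb
  have hpb := side_polyBounded K k hb
  have hm : PolyTime fun x => blowSize K k (M x).length := by unfold blowSize; fun_prop
  have hmb : PolyBounded fun x => blowSize K k (M x).length := hb.mul (hpb.mul hpb)
  have ha := ratTri hα hm hmb
  have hb := ratTri hβ hm hmb
  refine hm.prodMk (mapRange (f := fun x u => (List.range (blowSize K k (M x).length)).map fun v =>
      CorrClust.blowEntry (M x) (CorrClust.side K k (M x).length) (CorrClust.totalWeight (M x))
        (CorrClust.ratTri (α (blowSize K k (M x).length)))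
        (CorrClust.ratTri (β (blowSize K k (M x).length))) u v) hm hmb ?_)
  refine mapRange (n := fun y : δ × ℕ => blowSize K k (M y.1).length)
    (f := fun (y : δ × ℕ) v =>
      CorrClust.blowEntry (M y.1) (CorrClust.side K k (M y.1).length) (CorrClust.totalWeight (M y.1))
        (CorrClust.ratTri (α (blowSize K k (M y.1).length)))
        (CorrClust.ratTri (β (blowSize K k (M y.1).length))) y.2 v) (hm.comp (by fun_prop))
    hmb.fst ?_
  have h₀ : PolyTime fun y : (δ × ℕ) × ℕ => y.1.1 := by fun_prop
  exact blowEntry (hM.comp h₀) (hp.comp h₀) (by fun_prop) (ha.comp h₀) (hb.comp h₀)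
    (by fun_prop) (by fun_prop)

/-- Whether a datum is a number. -/
def _root_.CorrClust.Data.isNumber : Data → Bool
  | .num _ => true
  | .pair _ _ => false

@[fun_prop]
theorem isNumber : PolyTime Data.isNumber := of_op .isNum fun d => by cases d <;> rfl

@[fun_prop]
theorem toNum : PolyTime toNum :=
  of_enc (g := fun d : Data => bif d.isNumber then d else .num 0) (by fun_prop)
    fun d => by cases d <;> rfl

/-- The number of pairs on the right spine of a datum. -/
def _root_.CorrClust.Data.depth : Data → ℕ
  | .num _ => 0
  | .pair _ b => b.depth + 1

/-- The output to be read may be any datum on unsuccessful coin flips, so the reader has to be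
total. It walks down the right spine, moving heads to an accumulator, and the total size of the
state never grows. -/
theorem toLabels : PolyTime toLabels := by
  let f : Data × List ℕ → Data × List ℕ := fun s =>
    (Op.snd.eval s.1, CorrClust.toNum (Op.fst.eval s.1) :: s.2)
  let c : Data × List ℕ → Bool := fun s => !s.1.isNumber
  have h₁ : ∀ d l, (f^[d.depth] (d, l)).2 = (CorrClust.toLabels d).reverse ++ l := by
    intro d
    induction d with
    | num k => simp [Data.depth, CorrClust.toLabels]
    | pair a b _ ih =>
      intro l
      rw [Data.depth, Function.iterate_succ_apply]
      refine (ih _).trans ?_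
      simp [CorrClust.toLabels, Op.eval]
  have h₂ : ∀ d l, c (f^[d.depth] (d, l)) = false := by
    intro d
    induction d with
    | num k => simp [Data.depth, c, Data.isNumber]
    | pair a b _ ih =>
      intro l
      rw [Data.depth, Function.iterate_succ_apply]
      exact ih _
  have h₃ : ∀ d l, ∀ j < d.depth, c (f^[j] (d, l)) = true := by
    intro d
    induction d with
    | num k => simp [Data.depth]
    | pair a b _ ih =>
      intro l j hj
      cases j with
      | zero => rfl
      | succ j => exact ih _ j (by simpa [Data.depth] using hj)
  have h₄ : ∀ d l, ∀ j ≤ d.depth, sz (f^[j] (d, l)) ≤ sz (d, l) := by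
    intro d
    induction d with
    | num k => intro l j hj; simp [Data.depth] at hj; simp [hj]
    | pair a b _ ih =>
      intro l j hj
      cases j with
      | zero => rfl
      | succ j =>
        refine (ih _ j (by simpa [Data.depth] using hj)).trans ?_
        rw [sz_prod, sz_cons, sz_prod]
        change sz b + (sz (CorrClust.toNum a) + sz l + 1) + 1 ≤ sz a + sz b + 1 + sz l + 1
        have : sz (CorrClust.toNum a) ≤ sz a := by
          cases a with
          | num k => rfl
          | pair a b => exact one_le_sz (Data.pair a b)
        omega
  have hdepth : ∀ d : Data, d.depth ≤ sz d := by
    intro d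
    induction d with
    | num k => simp [Data.depth]
    | pair a b _ ih =>
      change b.depth + 1 ≤ sz a + sz b + 1
      omega
  have : CorrClust.toLabels = fun d => (f^[d.depth] (d, [])).2.reverse := by
    funext d; rw [h₁]; simp
  rw [this]
  have hop := PolyTime.op
  refine (iterate (init := fun d : Data => (d, ([] : List ℕ))) (c := c) (f := f) (by fun_prop)
    (by fun_prop) ?_ (PolyBounded.sz.mono hdepth) (fun d => h₃ d _) (fun d => h₂ d _)
    ((PolyBounded.sz).add (.const 2)) fun d => h₄ d _).snd.reverse
  have hf : PolyTime f :=
    prodMk (comp (hop .snd) (by fun_prop))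
      (cons (toNum.comp (comp (hop .fst) (by fun_prop))) (by fun_prop))
  obtain ⟨d, p, h⟩ := hf
  exact ⟨d, p, fun s _ => h s⟩

theorem normalize {n : δ → ℕ} {L : δ → List ℕ} (hn : PolyTime n) (hb : PolyBounded n)
    (hL : PolyTime L) : PolyTime fun x => normalize (n x) (L x) :=
  mapRange (f := fun x i => (L x).getD i 0) hn hb (by fun_prop)

theorem bestLabels (K k : ℕ) (brute : List (List ℕ)) {M : δ → Mat} {L : δ → List ℕ}
    (hM : PolyTime M) (hL : PolyTime L) :
    PolyTime fun x => bestLabels K k brute (M x) (L x) := by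
  have hn := hM.length
  have hb := hM.length_polyBounded
  have hp := side K k hn hb
  have hpb := side_polyBounded K k hb
  refine PolyTime.best (f := fun x => CorrClust.score (M x)) (by fun_prop)
    (PolyTime.best (f := fun x => CorrClust.score (M x)) (by fun_prop) (range hn hb) (by fun_prop))
    (mapRange (f := fun x q => candidate (M x).length (CorrClust.side K k (M x).length) (L x) q)
      (by fun_prop) (hpb.pow 4) ?_)
  have h₀ : PolyTime fun y : (δ × ℕ) × ℕ => y.1.1 := by fun_prop
  have hp' := hp.comp h₀
  have hn' : PolyTime fun y : δ × ℕ => (M y.1).length :=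
    hn.comp (g := fun y : δ × ℕ => y.1) (by fun_prop)
  exact mapRange (f := fun (y : δ × ℕ) i => (L y.1).getD
    (i * (CorrClust.side K k (M y.1).length * CorrClust.side K k (M y.1).length) +
    ((y.2 % CorrClust.side K k (M y.1).length + (y.2 / CorrClust.side K k (M y.1).length %
      CorrClust.side K k (M y.1).length) * i) % CorrClust.side K k (M y.1).length *
        CorrClust.side K k (M y.1).length +
      (y.2 / (CorrClust.side K k (M y.1).length * CorrClust.side K k (M y.1).length) %
        CorrClust.side K k (M y.1).length +
        (y.2 / (CorrClust.side K k (M y.1).length * CorrClust.side K k (M y.1).length *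
          CorrClust.side K k (M y.1).length) % CorrClust.side K k (M y.1).length) * i) %
            CorrClust.side K k (M y.1).length)) 0) hn' hb.fst (by fun_prop)

/-! ### Computing the size of a datum -/

/-- Sizes must be computed by the program itself, because the number of coins for the blow-up is a
polynomial in the size of its encoding. Binary digits are counted by repeated halving. -/
theorem sz_nat : PolyTime fun n : ℕ => sz n := by
  let f : ℕ × ℕ → ℕ × ℕ := fun s => (s.1 / 2, s.2 + 1)
  have hf : ∀ n j, f^[j] (n, 0) = (n / 2 ^ j, j) := by
    intro n j
    induction j with
    | zero => simp
    | succ j ih => rw [Function.iterate_succ_apply', ih, pow_succ, ← Nat.div_div_eq_div_mul]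
  have : (fun n : ℕ => sz n) = fun n => (f^[Nat.size n] (n, 0)).2 + 1 := by
    funext n; rw [hf]; rfl
  rw [this]
  refine (iterate (init := fun n : ℕ => (n, 0)) (c := fun s => Nat.blt 0 s.1) (f := f)
    (B := fun n => sz n + (sz n + 1) + 1) (by fun_prop) (by fun_prop) ?_
    (PolyBounded.sz.mono fun n => ?_) ?_ ?_ ?_ ?_).snd.add (const 1)
  · obtain ⟨d, p, h⟩ : PolyTime f := by fun_prop
    exact ⟨d, p, fun s _ => h s⟩
  · rw [CorrClust.sz_nat]; omega
  · intro n j hj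
    rw [hf]
    exact Nat.ble_eq.mpr (Nat.div_pos (Nat.lt_size.1 hj) (by positivity))
  · intro n
    rw [hf, Nat.div_eq_of_lt (Nat.lt_size_self n)]
    rfl
  · exact (PolyBounded.sz.add (PolyBounded.sz.add (.const 1))).add (.const 1)
  · intro n j hj
    rw [hf, sz_prod]
    have h₁ := sz_le_of_le (Nat.div_le_self n (2 ^ j))
    have h₂ := sz_nat_le j
    rw [CorrClust.sz_nat n] at *
    omega

theorem sz_pair {α β : Type} [Enc α] [Enc β] (hα : PolyTime fun a : α => sz a)
    (hβ : PolyTime fun b : β => sz b) : PolyTime fun x : α × β => sz x :=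
  ((hα.comp fst').add (hβ.comp snd')).add (const 1)

theorem sz_list {α : Type} [Enc α] (hα : PolyTime fun a : α => sz a) :
    PolyTime fun l : List α => sz l := by
  have : (fun l : List α => sz l) = fun l => (l.map fun a => sz a + 1).sum + 1 := by
    funext l
    induction l with
    | nil => rfl
    | cons a l ih => rw [sz_cons, ih, List.map_cons, List.sum_cons]; omega
  rw [this]
  exact (map (f := fun _ a => sz a + 1) (by fun_prop) (by fun_prop)).sum.add (const 1)

theorem sz_mat : PolyTime fun x : ℕ × Mat => sz x :=
  sz_pair sz_nat (sz_list (sz_list (sz_pair sz_nat (sz_pair sz_nat sz_nat))))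

end PolyTime

end

/-! ### The reduction as a program -/

section

variable (α β : ℕ → ℚ) (K k : ℕ) (q : Polynomial ℕ) (brute : List (List ℕ))

/-- The number of coins needed on the blow-up. -/
def coinCount (M : Mat) : ℕ := q.eval (sz (blow α β K k M))

/-- Build the blow-up and select the coins for it. -/
def preprocess (x : (ℕ × Mat) × List ℕ) : (ℕ × Mat) × List ℕ :=
  (blow α β K k x.1.2, normalize (coinCount α β K k q x.1.2) x.2)

/-- Turn the output on the blow-up into the final output. -/
def postprocess (x : ((ℕ × Mat) × List ℕ) × Data) : List ℕ :=
  normalize x.1.1.2.length (bestLabels K k brute x.1.1.2 (toLabels x.2))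

variable {α β}

theorem PolyTime.preprocess (hα : PolyTimeComputable α) (hβ : PolyTimeComputable β) :
    PolyTime (preprocess α β K k q) := by
  have hM : PolyTime fun x : (ℕ × Mat) × List ℕ => x.1.2 := by fun_prop
  have hblow := blow hα hβ K k hM
  exact hblow.prodMk (normalize (eval q (sz_mat.comp hblow)) (hblow.size_polyBounded.eval q)
    (by fun_prop))

theorem PolyTime.postprocess : PolyTime (postprocess K k brute) := by
  have hM : PolyTime fun x : ((ℕ × Mat) × List ℕ) × Data => x.1.1.2 := by fun_prop
  exact normalize hM.length hM.length_polyBounded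
    (bestLabels K k brute hM (toLabels.comp (by fun_prop)))

theorem coinCount_polyBounded (hα : PolyTimeComputable α) (hβ : PolyTimeComputable β) :
    PolyBounded fun x : ℕ × Mat => coinCount α β K k q x.2 :=
  (PolyTime.blow hα hβ K k (M := fun x : ℕ × Mat => x.2)
    (by fun_prop)).size_polyBounded.eval q

end

end CorrClust

/-! ### Pseudorandomness of the incidence form over a finite field -/

namespace CorrClust

section Discrepancy

variable {F : Type*} [Field F] [Fintype F]

/-- Two affine forms with different slopes parametrize the plane. -/
theorem sum_affine_pair {s t : F} (hst : s ≠ t) (h : F → F → ℝ) :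
    ∑ y : F × F, h (s * y.1 + y.2) (t * y.1 + y.2) = ∑ z : F × F, h z.1 z.2 := by
  have hinj : Function.Injective fun y : F × F => (s * y.1 + y.2, t * y.1 + y.2) := by
    intro y z hyz
    simp only [Prod.mk.injEq] at hyz
    have h₁ : (s - t) * (y.1 - z.1) = 0 := by linear_combination hyz.1 - hyz.2
    have h₂ : y.1 = z.1 := by
      rcases mul_eq_zero.1 h₁ with h | h
      · exact absurd (sub_eq_zero.1 h) hst
      · exact sub_eq_zero.1 h
    refine Prod.ext h₂ ?_
    have := hyz.1
    rw [h₂] at this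
    exact add_left_cancel this
  exact Fintype.sum_bijective _ (Finite.injective_iff_bijective.1 hinj) _ _ fun _ => rfl

/-- The bilinear incidence form. -/
def inc (x y : F × F) : F := x.1 * y.1 + x.2 + y.2

theorem sum_add_left (f : F → ℝ) (c : F) : ∑ v, f (c + v) = ∑ v, f v :=
  Equiv.sum_comp (Equiv.addLeft c) f

theorem sum_inc (f : F → ℝ) (x : F × F) :
    ∑ y, f (inc x y) = Fintype.card F * ∑ v, f v := by
  simp_rw [inc, Fintype.sum_prod_type, sum_add_left]
  simp

/-- As `y` varies, affine forms with different slopes are independent and uniform, so the sum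
factors into two vanishing ones. -/
theorem cov_eq_zero {f : F → ℝ} (hf : ∑ v, f v = 0) {x x' : F × F} (h : x.1 ≠ x'.1) :
    ∑ y, f (inc x y) * f (inc x' y) = 0 := by
  have h₁ := sum_affine_pair h fun u v => f (x.2 + u) * f (x'.2 + v)
  have h₂ : ∀ x y : F × F, inc x y = x.2 + (x.1 * y.1 + y.2) := fun x y => by rw [inc]; ring
  simp_rw [h₂]
  rw [h₁, Fintype.sum_prod_type]
  simp_rw [← Finset.mul_sum, sum_add_left, hf]
  simp

theorem abs_cov_le (f : F → ℝ) (x x' : F × F) :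
    |∑ y, f (inc x y) * f (inc x' y)| ≤ Fintype.card F * ∑ v, f v ^ 2 := by
  have h₁ := sum_inc (fun v => f v ^ 2) x
  have h₂ := sum_inc (fun v => f v ^ 2) x'
  calc |∑ y, f (inc x y) * f (inc x' y)|
      ≤ ∑ y, |f (inc x y) * f (inc x' y)| := Finset.abs_sum_le_sum_abs _ _
    _ ≤ ∑ y, (f (inc x y) ^ 2 + f (inc x' y) ^ 2) / 2 := by
        refine Finset.sum_le_sum fun y _ => abs_le.2 ⟨?_, ?_⟩ <;>
          nlinarith [sq_nonneg (f (inc x y) + f (inc x' y)), sq_nonneg (f (inc x y) - f (inc x' y))]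
    _ = _ := by rw [← Finset.sum_div, Finset.sum_add_distrib, h₁, h₂]; ring

theorem sum_sq_fibers {ι κ : Type*} [Fintype ι] [DecidableEq κ] (c : ι → κ) (g : ι → ℝ) :
    ∑ k ∈ Finset.univ.image c, (∑ x, if c x = k then g x else 0) ^ 2 =
      ∑ x, ∑ x', if c x = c x' then g x * g x' else 0 := by
  simp_rw [sq, Finset.sum_mul_sum]
  rw [Finset.sum_comm]
  refine Finset.sum_congr rfl fun x _ => ?_
  rw [Finset.sum_comm]
  refine Finset.sum_congr rfl fun x' _ => ?_
  rw [Finset.sum_eq_single (c x)]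
  · by_cases h : c x = c x'
    · simp [h]
    · simp [h, Ne.symm h]
  · intro k _ hk
    simp [Ne.symm hk]
  · intro h
    exact absurd (Finset.mem_image_of_mem c (Finset.mem_univ x)) h

/-- Blocks of rows and columns cut out by a labelling see the average of the matrix
`f (inc x y)`, up to a small error. -/
theorem discrepancy_sq_le {κ : Type*} [DecidableEq κ] {f : F → ℝ} (hf : ∑ v, f v = 0)
    (c c' : F × F → κ) :
    (∑ x, ∑ y, if c x = c' y then f (inc x y) else 0) ^ 2 ≤
      (Fintype.card F : ℝ) ^ 6 * ∑ v, f v ^ 2 := by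
  classical
  set p : ℝ := (Fintype.card F : ℝ) with hp
  set S : ℝ := ∑ v, f v ^ 2 with hS
  have hS₀ : 0 ≤ S := Finset.sum_nonneg fun v _ => sq_nonneg _
  have hp₀ : 0 ≤ p := Nat.cast_nonneg _
  -- Column `y` sees at most one class of `c`. Summing the squares over all classes of `c` only
  -- enlarges the bound and eliminates `c'`.
  have hrow : ∀ y, (∑ x, if c x = c' y then f (inc x y) else 0) ^ 2 ≤
      ∑ x, ∑ x', if c x = c x' then f (inc x y) * f (inc x' y) else 0 := by
    intro y
    rw [← sum_sq_fibers c fun x => f (inc x y)]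
    by_cases h : c' y ∈ Finset.univ.image c
    · exact Finset.single_le_sum
        (f := fun k => (∑ x, if c x = k then f (inc x y) else 0) ^ 2) (fun _ _ => sq_nonneg _) h
    · have : (∑ x, if c x = c' y then f (inc x y) else 0) = 0 := by
        refine Finset.sum_eq_zero fun x _ => if_neg fun hx => h ?_
        exact hx ▸ Finset.mem_image_of_mem c (Finset.mem_univ x)
      rw [this, sq, zero_mul]
      exact Finset.sum_nonneg fun _ _ => sq_nonneg _
  have hcov : ∀ x x' : F × F, (∑ y, if c x = c x' then f (inc x y) * f (inc x' y) else 0) ≤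
      if x'.1 = x.1 then p * S else 0 := by
    intro x x'
    by_cases h : x'.1 = x.1
    · rw [if_pos h]
      by_cases hc : c x = c x'
      · simp only [hc, if_true]
        exact (le_abs_self _).trans (abs_cov_le f x x')
      · simp only [hc, if_false, Finset.sum_const_zero]
        positivity
    · rw [if_neg h]
      by_cases hc : c x = c x'
      · simp only [hc, if_true]
        exact (cov_eq_zero hf (Ne.symm h)).le
      · simp [hc]
  rw [Finset.sum_comm]
  -- Cauchy-Schwarz over the `p²` columns costs `p²`. Afterwards only the `p³` pairs of rows with
  -- equal first coordinate survive, each contributing at most `p * S`.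
  calc (∑ y, ∑ x, if c x = c' y then f (inc x y) else 0) ^ 2
      ≤ (Finset.univ : Finset (F × F)).card *
          ∑ y, (∑ x, if c x = c' y then f (inc x y) else 0) ^ 2 := sq_sum_le_card_mul_sum_sq
    _ ≤ p ^ 2 * ∑ y, ∑ x, ∑ x', if c x = c x' then f (inc x y) * f (inc x' y) else 0 := by
        rw [Finset.card_univ, Fintype.card_prod, Nat.cast_mul, ← hp, ← sq]
        gcongr with y
        exact hrow y
    _ = p ^ 2 * ∑ x, ∑ x', ∑ y, if c x = c x' then f (inc x y) * f (inc x' y) else 0 := by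
        rw [Finset.sum_comm]
        congr 1
        exact Finset.sum_congr rfl fun x _ => Finset.sum_comm
    _ ≤ p ^ 2 * ∑ x : F × F, ∑ x' : F × F, if x'.1 = x.1 then p * S else 0 := by
        gcongr with x _ x' _
        exact hcov x x'
    _ = p ^ 6 * S := by
        have : ∀ x : F × F, (∑ x' : F × F, if x'.1 = x.1 then p * S else 0) = p * (p * S) := by
          intro x
          rw [Fintype.sum_prod_type]
          change (∑ u : F, ∑ _v : F, if u = x.1 then p * S else 0) = _
          simp [← hp]
        simp_rw [this, Finset.sum_const, Finset.card_univ, Fintype.card_prod]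
        simp [← hp]
        ring

end Discrepancy

section Pairs

variable {p : ℕ} [Fact p.Prime]

theorem card_val_lt {T : ℕ} (hT : T ≤ p) :
    ∑ v : ZMod p, (if v.val < T then (1 : ℝ) else 0) = T := by
  have : ∑ v : ZMod p, (if v.val < T then (1 : ℝ) else 0) =
      ∑ i ∈ Finset.range p, if i < T then (1 : ℝ) else 0 := by
    refine Finset.sum_bij (fun v _ => v.val) (fun v _ => Finset.mem_range.2 v.val_lt)
      (fun v _ w _ h => ZMod.val_injective p h) (fun i hi => ⟨(i : ZMod p), Finset.mem_univ _, ?_⟩)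
      fun v _ => rfl
    exact ZMod.val_cast_of_lt (Finset.mem_range.1 hi)
  rw [this, Finset.sum_boole]
  congr 1
  rw [show (Finset.range p).filter (fun i => i < T) = Finset.range T by
    ext i; simp; omega]
  simp

/-- In the random-like bipartite graph `inc x y < T`, the number of edges inside (`b = true`) or
between (`b = false`) the blocks of a labelling is close to its expectation. -/
theorem pair_estimate {κ : Type*} [DecidableEq κ] {T : ℕ} (hT : T ≤ p) {g e ρ : ℝ} (hg : 0 ≤ g)
    (he : 0 ≤ e) (he₁ : e ≤ 1) (hρ₁ : ρ ≤ 1) (hlow : g * T ≤ ρ * p) (hupp : ρ * p ≤ g * T + g)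
    (hge : g ≤ e ^ 2 * p) (c c' : ZMod p × ZMod p → κ) (b : Bool) :
    |(∑ x, ∑ y, if decide (c x = c' y) = b then (if (inc x y).val < T then g else 0) else 0) -
      ρ * ∑ x, ∑ y, if decide (c x = c' y) = b then (1 : ℝ) else 0| ≤ 2 * e * p ^ 4 := by
  have hp : (0 : ℝ) < p := by exact_mod_cast (Fact.out : p.Prime).pos
  -- The centred indicator of the residues below `T`; its sum of squares is at most `T`.
  let f : ZMod p → ℝ := fun v => (if v.val < T then 1 else 0) - T / p
  have hf : ∑ v, f v = 0 := by
    rw [Finset.sum_sub_distrib, card_val_lt hT]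
    simp [ZMod.card]
    field_simp
    simp
  have hS : ∑ v, f v ^ 2 ≤ T := by
    have : ∀ v, f v ^ 2 = (if v.val < T then (1 : ℝ) else 0) * (1 - 2 * (T / p)) + (T / p) ^ 2 := by
      intro v
      simp only [f]
      split <;> ring
    simp_rw [this]
    rw [Finset.sum_add_distrib, ← Finset.sum_mul, card_val_lt hT]
    simp only [Finset.sum_const, Finset.card_univ, ZMod.card, nsmul_eq_mul]
    have : (p : ℝ) * (T / p) ^ 2 = T * (T / p) := by field_simp
    rw [this]
    have : (0 : ℝ) ≤ T * (T / p) := by positivity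
    nlinarith
  have hdisc := discrepancy_sq_le hf c c'
  rw [ZMod.card] at hdisc
  set D := ∑ x, ∑ y, if c x = c' y then f (inc x y) else 0 with hD
  have hgT : g * T ≤ 1 * p := hlow.trans (by gcongr)
  -- One factor of `g` is absorbed by the mean, since `g * T ≤ p`, and the other by `g ≤ e² p`. The
  -- squared deviation is thus at most `e² p⁸`.
  have hgD : |g * D| ≤ e * p ^ 4 := by
    refine abs_le_of_sq_le_sq (by
      rw [mul_pow]
      calc g ^ 2 * D ^ 2 ≤ g ^ 2 * (p ^ 6 * T) := by
            gcongr
            exact hdisc.trans (by gcongr)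
        _ = g * p ^ 6 * (g * T) := by ring
        _ ≤ (e ^ 2 * p) * p ^ 6 * (1 * p) := by
            gcongr
        _ = (e * p ^ 4) ^ 2 := by ring) (by positivity)
  have hall : ∑ x, ∑ y, f (inc x y) = 0 := by
    simp_rw [sum_inc, hf]
    simp
  have hDb : |g * ∑ x, ∑ y, if decide (c x = c' y) = b then f (inc x y) else 0| ≤ e * p ^ 4 := by
    cases b
    · have : (∑ x, ∑ y, if decide (c x = c' y) = false then f (inc x y) else 0) = -D := by
        rw [eq_neg_iff_add_eq_zero]
        refine Eq.trans ?_ hall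
        rw [hD, ← Finset.sum_add_distrib]
        refine Finset.sum_congr rfl fun x _ => ?_
        rw [← Finset.sum_add_distrib]
        refine Finset.sum_congr rfl fun y _ => ?_
        by_cases h : c x = c' y <;> simp [h]
      rw [this, mul_neg, abs_neg]
      exact hgD
    · simpa using hgD
  set N := ∑ x, ∑ y, if decide (c x = c' y) = b then (1 : ℝ) else 0 with hN
  have hN₀ : 0 ≤ N := Finset.sum_nonneg fun x _ => Finset.sum_nonneg fun y _ => by
    split <;> norm_num
  have hN₁ : N ≤ p ^ 4 := by
    calc N ≤ ∑ x : ZMod p × ZMod p, ∑ y : ZMod p × ZMod p, (1 : ℝ) := by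
          rw [hN]
          gcongr
          split <;> norm_num
      _ = p ^ 4 := by simp [ZMod.card]; ring
  have hsplit : (∑ x, ∑ y,
      if decide (c x = c' y) = b then (if (inc x y).val < T then g else 0) else 0) =
      (g * ∑ x, ∑ y, if decide (c x = c' y) = b then f (inc x y) else 0) + g * T / p * N := by
    simp only [hN, Finset.mul_sum, ← Finset.sum_add_distrib]
    refine Finset.sum_congr rfl fun x _ => Finset.sum_congr rfl fun y _ => ?_
    simp only [f]
    split_ifs <;> ring
  -- Rounding in `T` shifts the mean weight by at most `g / p ≤ e² ≤ e`. Together with the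
  -- discrepancy this gives the constant `2 * e`.
  have hρN : |g * T / p * N - ρ * N| ≤ e * p ^ 4 := by
    have h₁ : g * T / p ≤ ρ := by rw [div_le_iff₀ hp]; exact hlow
    have h₂ : ρ ≤ g * T / p + g / p := by
      rw [← add_div, le_div_iff₀ hp]; exact hupp
    have h₃ : g / p ≤ e := by
      rw [div_le_iff₀ hp]
      refine hge.trans ?_
      gcongr
      nlinarith
    rw [← sub_mul, abs_mul, abs_of_nonneg hN₀]
    gcongr
    rw [abs_le]
    constructor <;> linarith
  rw [hsplit]
  calc _ = |(g * ∑ x, ∑ y, if decide (c x = c' y) = b then f (inc x y) else 0) +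
        (g * T / p * N - ρ * N)| := by congr 1; ring
    _ ≤ _ := (abs_add_le _ _).trans (by linarith)

end Pairs

end CorrClust

/-! ### Values of clusterings -/

namespace CorrClust

section Value

variable {n : ℕ}

open Classical in
/-- The value of a clustering, summed over ordered pairs. -/
noncomputable def WGraph.value (G : WGraph n) (C : Setoid (Fin n)) : ℝ :=
  ∑ i, ∑ j, if decide (C.r i j) = decide (0 ≤ G.w i j) then |(G.w i j : ℝ)| else 0

theorem sum_sum_eq_two_mul (F : Fin n → Fin n → ℝ) (hs : ∀ i j, F i j = F j i)
    (h₀ : ∀ i, F i i = 0) :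
    ∑ i, ∑ j, F i j = 2 * ∑ e : Fin n × Fin n with e.1 < e.2, F e.1 e.2 := by
  have h₁ : ∑ i, ∑ j, F i j = (∑ e : Fin n × Fin n, if e.1 < e.2 then F e.1 e.2 else 0) +
      ∑ e : Fin n × Fin n, if e.2 < e.1 then F e.1 e.2 else 0 := by
    rw [← Finset.sum_add_distrib, ← Fintype.sum_prod_type']
    refine Finset.sum_congr rfl fun e _ => ?_
    rcases lt_trichotomy e.1 e.2 with h | h | h
    · simp [h, h.not_gt]
    · simp [h, h₀]
    · simp [h, h.not_gt]
  have h₂ : (∑ e : Fin n × Fin n, if e.2 < e.1 then F e.1 e.2 else 0) =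
      ∑ e : Fin n × Fin n, if e.1 < e.2 then F e.1 e.2 else 0 := by
    rw [← (Equiv.prodComm (Fin n) (Fin n)).sum_comp]
    refine Finset.sum_congr rfl fun e _ => ?_
    simp [hs]
  rw [h₁, h₂, Finset.sum_filter]
  ring

theorem WGraph.value_eq (G : WGraph n) (C : Setoid (Fin n)) :
    G.value C = 2 * (G.agree C : ℝ) := by
  classical
  rw [WGraph.value, sum_sum_eq_two_mul]
  · rw [WGraph.agree, Rat.cast_sum]
    congr 1
    refine Finset.sum_congr rfl fun e _ => ?_
    by_cases h : C.r e.1 e.2 <;> by_cases hw : 0 ≤ G.w e.1 e.2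
    · simp [h, hw]
    · simp [h, hw, le_of_not_ge hw]
    · simp [h, hw]
    · have : (G.w e.1 e.2 : ℝ) < 0 := by exact_mod_cast not_le.1 hw
      simp [h, hw, le_of_not_ge hw, abs_of_neg this]
  · intro i j
    rw [G.symm i j]
    have : C.r i j ↔ C.r j i := ⟨C.symm, C.symm⟩
    simp [this]
  · intro i
    simp [G.loopless]

theorem WGraph.value_nonneg (G : WGraph n) (C : Setoid (Fin n)) : 0 ≤ G.value C :=
  Finset.sum_nonneg fun i _ => Finset.sum_nonneg fun j _ => by split <;> positivity

theorem WGraph.isApprox_iff (G : WGraph n) (ρ : ℝ) (C : Setoid (Fin n)) :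
    G.IsApprox ρ C ↔ ∀ C', G.value C' ≤ ρ * G.value C := by
  refine forall_congr' fun C' => ?_
  rw [G.value_eq, G.value_eq]
  constructor <;> intro h <;> linarith

/-- The total absolute weight of all ordered pairs. -/
noncomputable def WGraph.total (G : WGraph n) : ℝ := ∑ i, ∑ j, |(G.w i j : ℝ)|

theorem WGraph.value_le_total (G : WGraph n) (C : Setoid (Fin n)) : G.value C ≤ G.total :=
  Finset.sum_le_sum fun i _ => Finset.sum_le_sum fun j _ => by
    split
    · exact le_rfl
    · exact abs_nonneg _

theorem WGraph.abs_w_le_total (G : WGraph n) (i j : Fin n) : |(G.w i j : ℝ)| ≤ G.total :=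
  (Finset.single_le_sum (f := fun j => |(G.w i j : ℝ)|) (fun _ _ => abs_nonneg _)
    (Finset.mem_univ j)).trans (Finset.single_le_sum (f := fun i => ∑ j, |(G.w i j : ℝ)|)
      (fun _ _ => Finset.sum_nonneg fun _ _ => abs_nonneg _) (Finset.mem_univ i))

/-- Each pair of distinct vertices agrees with exactly one of the two trivial clusterings. The
better one therefore has at least half of the total weight. -/
theorem WGraph.value_top_add_value_bot (G : WGraph n) : G.value ⊤ + G.value ⊥ = G.total := by
  classical
  simp only [WGraph.value, WGraph.total, ← Finset.sum_add_distrib]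
  refine Finset.sum_congr rfl fun i _ => Finset.sum_congr rfl fun j _ => ?_
  have h₁ : (⊤ : Setoid (Fin n)).r i j := trivial
  have h₂ : (⊥ : Setoid (Fin n)).r i j ↔ i = j := Iff.rfl
  simp only [h₁, h₂]
  by_cases hij : i = j
  · subst hij; simp [G.loopless]
  · by_cases hw : 0 ≤ G.w i j <;> simp [hij, hw]

end Value

/-! ### The blow-up, lifting clusterings to it and projecting them back -/

section BlowUp

variable {n p : ℕ}

/-- The block of a vertex of the blow-up. -/
def blk (u : Fin (n * (p * p))) : Fin n :=
  ⟨u / (p * p), Nat.div_lt_of_lt_mul (lt_of_lt_of_eq u.2 (mul_comm _ _))⟩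

/-- Whether the coordinates of two vertices are incident. -/
def incNat (p u v : ℕ) : ℕ := ((u / p % p) * (v / p % p) + u % p + v % p) % p

theorem incNat_comm (p u v : ℕ) : incNat p u v = incNat p v u := by
  rw [incNat, incNat]; congr 1; ring

/-- The blow-up of a graph in which the blocks `i`, `j` are joined by a random-like bipartite
graph of density `T i j / p`. -/
def WGraph.blowUp (G : WGraph n) (p : ℕ) (T : Fin n → Fin n → ℕ) (hT : ∀ i j, T i j = T j i)
    (hT₀ : ∀ i, T i i = 0) (a b : ℚ) : WGraph (n * (p * p)) where
  w u v := if incNat p u v < T (blk u) (blk v) then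
    (if G.w (blk u) (blk v) < 0 then -a else b) else 0
  symm u v := by rw [incNat_comm, hT, G.symm]
  loopless u := by rw [hT₀]; simp

variable [Fact p.Prime]

/-- The vertex of the blow-up with given block and coordinates. -/
def vtx (i : Fin n) (x : ZMod p × ZMod p) : Fin (n * (p * p)) :=
  ⟨i * (p * p) + (x.1.val * p + x.2.val), by
    have h₁ := x.1.val_lt
    have h₂ := x.2.val_lt
    have h₃ := i.2
    have h₄ : x.1.val * p + x.2.val < p * p := by nlinarith
    nlinarith⟩

theorem vtx_lt (x : ZMod p × ZMod p) : x.1.val * p + x.2.val < p * p := by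
  have h₁ := x.1.val_lt
  have h₂ := x.2.val_lt
  nlinarith

theorem blk_vtx (i : Fin n) (x : ZMod p × ZMod p) : blk (vtx i x) = i := by
  have h := vtx_lt x
  refine Fin.ext ?_
  simp only [blk, vtx]
  rw [mul_comm, Nat.mul_add_div (by omega), Nat.div_eq_of_lt h, add_zero]

theorem vtx_mod (i : Fin n) (x : ZMod p × ZMod p) : (vtx i x : ℕ) % p = x.2.val := by
  simp only [vtx]
  rw [show (i : ℕ) * (p * p) + (x.1.val * p + x.2.val) = x.2.val + p * (i * p + x.1.val) by ring,
    Nat.add_mul_mod_self_left, Nat.mod_eq_of_lt x.2.val_lt]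

theorem vtx_div_mod (i : Fin n) (x : ZMod p × ZMod p) : (vtx i x : ℕ) / p % p = x.1.val := by
  have hp : 0 < p := (Fact.out : p.Prime).pos
  simp only [vtx]
  rw [show (i : ℕ) * (p * p) + (x.1.val * p + x.2.val) = x.2.val + p * (x.1.val + p * i) by ring,
    Nat.add_mul_div_left _ _ hp, Nat.div_eq_of_lt x.2.val_lt, zero_add, Nat.add_mul_mod_self_left,
    Nat.mod_eq_of_lt x.1.val_lt]

theorem incNat_vtx (i j : Fin n) (x y : ZMod p × ZMod p) :
    incNat p (vtx i x) (vtx j y) = (inc x y).val := by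
  rw [incNat, vtx_mod, vtx_mod, vtx_div_mod, vtx_div_mod, inc, ← ZMod.val_natCast]
  push_cast
  simp only [ZMod.natCast_val, ZMod.cast_id', id_eq]

theorem vtx_bijective : Function.Bijective fun z : Fin n × (ZMod p × ZMod p) => vtx z.1 z.2 := by
  rw [Fintype.bijective_iff_injective_and_card]
  refine ⟨fun z z' h => ?_, by simp [ZMod.card]⟩
  simp only at h
  have h₁ := blk_vtx z.1 z.2
  have h₂ := vtx_mod z.1 z.2
  have h₃ := vtx_div_mod z.1 z.2
  rw [h, blk_vtx] at h₁
  rw [h, vtx_mod] at h₂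
  rw [h, vtx_div_mod] at h₃
  exact Prod.ext h₁.symm
    (Prod.ext (ZMod.val_injective p h₃.symm) (ZMod.val_injective p h₂.symm))

theorem sum_vtx (F : Fin (n * (p * p)) → ℝ) : ∑ u, F u = ∑ i : Fin n, ∑ x, F (vtx i x) := by
  rw [← Fintype.sum_prod_type']
  exact (Fintype.sum_bijective _ vtx_bijective _ _ fun _ => rfl).symm

open Classical in
/-- The value of a clustering of the blow-up if every edge were replaced by its expectation. -/
noncomputable def WGraph.spread (G : WGraph n) (C : Setoid (Fin (n * (p * p)))) : ℝ :=
  ∑ i, ∑ j, |(G.w i j : ℝ)| * ∑ x : ZMod p × ZMod p, ∑ y : ZMod p × ZMod p,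
    if decide (C.r (vtx i x) (vtx j y)) = decide (0 ≤ G.w i j) then (1 : ℝ) else 0

/-- A clustering of the blow-up labels the points of each block by their cluster. The estimate for
two blocks applies to each of the `n²` ordered pairs of blocks, and the errors add up. -/
theorem WGraph.abs_value_blowUp_sub_le (G : WGraph n) (hG : 0 < G.total)
    {T : Fin n → Fin n → ℕ} (hT : ∀ i j, T i j = T j i) (hT₀ : ∀ i, T i i = 0) {a b : ℚ}
    (ha : 0 < a) (hb : 0 < b) (hTp : ∀ i j, T i j ≤ p) {e : ℝ} (he : 0 ≤ e) (he₁ : e ≤ 1)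
    (hlow : ∀ i j, ((if G.w i j < 0 then a else b : ℚ) : ℝ) * T i j ≤ |(G.w i j : ℝ)| / G.total * p)
    (hupp : ∀ i j, |(G.w i j : ℝ)| / G.total * p ≤ ((if G.w i j < 0 then a else b : ℚ) : ℝ) * T i j
      + ((if G.w i j < 0 then a else b : ℚ) : ℝ))
    (hae : (a : ℝ) ≤ e ^ 2 * p) (hbe : (b : ℝ) ≤ e ^ 2 * p) (C : Setoid (Fin (n * (p * p)))) :
    |(G.blowUp p T hT hT₀ a b).value C - G.spread C / G.total| ≤ (n : ℝ) ^ 2 * (2 * e * p ^ 4) := by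
  classical
  have ha' : (0 : ℝ) < a := by exact_mod_cast ha
  have hb' : (0 : ℝ) < b := by exact_mod_cast hb
  have hval : (G.blowUp p T hT hT₀ a b).value C = ∑ i, ∑ j, ∑ x : ZMod p × ZMod p,
      ∑ y : ZMod p × ZMod p, if decide (C.r (vtx i x) (vtx j y)) = decide (0 ≤ G.w i j) then
        (if (inc x y).val < T i j then ((if G.w i j < 0 then a else b : ℚ) : ℝ) else 0) else 0 := by
    simp_rw [WGraph.value, sum_vtx]
    refine Finset.sum_congr rfl fun i _ => ?_
    rw [Finset.sum_comm]
    refine Finset.sum_congr rfl fun j _ => Finset.sum_congr rfl fun x _ =>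
      Finset.sum_congr rfl fun y _ => ?_
    have hw : (G.blowUp p T hT hT₀ a b).w (vtx i x) (vtx j y) =
        if (inc x y).val < T i j then (if G.w i j < 0 then -a else b) else 0 := by
      simp only [WGraph.blowUp, incNat_vtx, blk_vtx]
    rw [hw]
    by_cases h₁ : (inc x y).val < T i j
    · by_cases h₂ : G.w i j < 0
      · simp [h₁, h₂, not_le.2 h₂, not_le.2 ha, abs_of_pos ha']
      · simp [h₁, h₂, not_lt.1 h₂, hb.le, abs_of_pos hb']
    · simp [h₁]
  have hsp : G.spread C / G.total = ∑ i, ∑ j, |(G.w i j : ℝ)| / G.total *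
      ∑ x : ZMod p × ZMod p, ∑ y : ZMod p × ZMod p,
        if decide (C.r (vtx i x) (vtx j y)) = decide (0 ≤ G.w i j) then (1 : ℝ) else 0 := by
    simp_rw [WGraph.spread, Finset.sum_div]
    refine Finset.sum_congr rfl fun i _ => Finset.sum_congr rfl fun j _ => ?_
    ring
  rw [hval, hsp, ← Finset.sum_sub_distrib]
  refine (Finset.abs_sum_le_sum_abs _ _).trans ?_
  calc _ ≤ ∑ i : Fin n, ∑ j : Fin n, (2 * e * (p : ℝ) ^ 4) := by
        refine Finset.sum_le_sum fun i _ => ?_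
        rw [← Finset.sum_sub_distrib]
        refine (Finset.abs_sum_le_sum_abs _ _).trans (Finset.sum_le_sum fun j _ => ?_)
        have hrel : ∀ x y : ZMod p × ZMod p, C.r (vtx i x) (vtx j y) ↔
            (Quotient.mk C (vtx i x)) = Quotient.mk C (vtx j y) := fun x y => Quotient.eq.symm
        simp_rw [hrel]
        refine pair_estimate (hTp i j) ?_ he he₁ ?_ (hlow i j) (hupp i j) ?_
          (fun x => Quotient.mk C (vtx i x)) (fun y => Quotient.mk C (vtx j y)) _
        · split <;> positivity
        · exact div_le_one_of_le₀ (G.abs_w_le_total i j) hG.le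
        · split
          · exact hae
          · exact hbe
    _ = _ := by simp; ring

/-- Keeping blocks whole transfers the optimum of `G` to the blow-up: all `p⁴` pairs of points in
two blocks agree or disagree together. -/
theorem WGraph.spread_comap_blk (G : WGraph n) (C : Setoid (Fin n)) :
    G.spread (C.comap (blk (p := p))) = (p : ℝ) ^ 4 * G.value C := by
  classical
  simp_rw [WGraph.spread, WGraph.value, Finset.mul_sum (a := (p : ℝ) ^ 4)]
  refine Finset.sum_congr rfl fun i _ => Finset.sum_congr rfl fun j _ => ?_
  have : ∀ x y : ZMod p × ZMod p, (C.comap (blk (p := p))).r (vtx i x) (vtx j y) ↔ C.r i j := by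
    intro x y
    change C.r (blk (vtx i x)) (blk (vtx j y)) ↔ _
    rw [blk_vtx, blk_vtx]
  simp_rw [this]
  split
  · simp [ZMod.card]; ring
  · simp

/-- The labels of the representatives given by two affine functions. -/
def repLabels (c : Fin (n * (p * p)) → ℕ) (q : (ZMod p × ZMod p) × (ZMod p × ZMod p))
    (i : Fin n) : ℕ :=
  c (vtx i (((i : ℕ) : ZMod p) * q.1.1 + q.1.2, ((i : ℕ) : ZMod p) * q.2.1 + q.2.2))

/-- Since `n ≤ p`, distinct block indices remain distinct modulo `p`. In each coordinate the affine
functions then take every pair of values at `i` and `j` exactly once, so each pair of points of the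
two blocks is counted once. -/
theorem sum_repLabels (G : WGraph n) (hn : n ≤ p) (c : Fin (n * (p * p)) → ℕ) :
    ∑ q, G.value (Setoid.ker (repLabels c q)) = G.spread (Setoid.ker c) := by
  classical
  simp_rw [WGraph.value, WGraph.spread]
  rw [Finset.sum_comm]
  refine Finset.sum_congr rfl fun i _ => ?_
  rw [Finset.sum_comm]
  refine Finset.sum_congr rfl fun j _ => ?_
  by_cases hij : i = j
  · subst hij; simp [G.loopless]
  have hne : ((i : ℕ) : ZMod p) ≠ ((j : ℕ) : ZMod p) := by
    intro h
    have := congrArg ZMod.val h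
    rw [ZMod.val_cast_of_lt (i.2.trans_le hn), ZMod.val_cast_of_lt (j.2.trans_le hn)] at this
    exact hij (Fin.ext this)
  let H : ZMod p → ZMod p → ZMod p → ZMod p → ℝ := fun x₁ y₁ x₂ y₂ =>
    if decide (c (vtx i (x₁, x₂)) = c (vtx j (y₁, y₂))) = decide (0 ≤ G.w i j) then 1 else 0
  have h₁ : ∀ q : (ZMod p × ZMod p) × (ZMod p × ZMod p),
      (if decide ((Setoid.ker (repLabels c q)).r i j) = decide (0 ≤ G.w i j) then
        |(G.w i j : ℝ)| else 0) = |(G.w i j : ℝ)| *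
      H ((i : ℕ) * q.1.1 + q.1.2) ((j : ℕ) * q.1.1 + q.1.2) ((i : ℕ) * q.2.1 + q.2.2)
        ((j : ℕ) * q.2.1 + q.2.2) := by
    intro q
    have : (Setoid.ker (repLabels c q)).r i j ↔ repLabels c q i = repLabels c q j := Iff.rfl
    simp only [this, repLabels, H]
    split <;> simp
  have h₂ : ∀ x y : ZMod p × ZMod p,
      (if decide ((Setoid.ker c).r (vtx i x) (vtx j y)) = decide (0 ≤ G.w i j) then (1 : ℝ) else 0) =
        H x.1 y.1 x.2 y.2 := by
    intro x y
    have : (Setoid.ker c).r (vtx i x) (vtx j y) ↔ c (vtx i x) = c (vtx j y) := Iff.rfl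
    simp only [this, H]
  simp_rw [h₁, h₂, ← Finset.mul_sum]
  congr 1
  rw [Fintype.sum_prod_type]
  have h₃ : ∀ s t : ZMod p, ∑ q : ZMod p × ZMod p,
      H s t ((i : ℕ) * q.1 + q.2) ((j : ℕ) * q.1 + q.2) = ∑ z : ZMod p × ZMod p, H s t z.1 z.2 :=
    fun s t => sum_affine_pair hne (H s t)
  simp_rw [h₃]
  have h₄ := sum_affine_pair hne fun s t => ∑ z : ZMod p × ZMod p, H s t z.1 z.2
  refine h₄.trans ?_
  simp_rw [Fintype.sum_prod_type]
  refine Finset.sum_congr rfl fun x _ => ?_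
  exact Finset.sum_comm

/-- Some choice of representatives does at least as well as the average. The approximation error `η`
enters twice: once for the lifted competitor, and once, multiplied by `r`, for the clustering found.
-/
theorem WGraph.exists_repLabels (G : WGraph n) (hn : n ≤ p) (hG : 0 < G.total)
    (G' : WGraph (n * (p * p))) {η r : ℝ} (hr : 0 ≤ r)
    (hG' : ∀ C, |G'.value C - G.spread C / G.total| ≤ η * p ^ 4) (c : Fin (n * (p * p)) → ℕ)
    (hc : G'.IsApprox r (Setoid.ker c)) :
    ∃ q, ∀ C, G.value C ≤ r * G.value (Setoid.ker (repLabels c q)) + (r + 1) * η * G.total := by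
  have hp : (0 : ℝ) < p := by exact_mod_cast (Fact.out : p.Prime).pos
  obtain ⟨q, -, hq⟩ := Finset.exists_le_of_sum_le (s := Finset.univ)
    (f := fun _ => G.spread (Setoid.ker c) / p ^ 4)
    (g := fun q => G.value (Setoid.ker (repLabels c q))) Finset.univ_nonempty (by
      rw [sum_repLabels G hn]
      simp [ZMod.card]
      field_simp
      rfl)
  refine ⟨q, fun C => ?_⟩
  rw [div_le_iff₀ (by positivity)] at hq
  have h₁ := (abs_le.1 (hG' (C.comap blk))).1
  have h₂ := (abs_le.1 (hG' (Setoid.ker c))).2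
  have h₃ := (G'.isApprox_iff r _).1 hc (C.comap blk)
  rw [G.spread_comap_blk] at h₁
  set v := G.value (Setoid.ker (repLabels c q))
  have h₄ : G.spread (Setoid.ker c) / G.total ≤ v * p ^ 4 / G.total := by gcongr
  have h₅ : r * G'.value (Setoid.ker c) ≤ r * (v * p ^ 4 / G.total + η * p ^ 4) := by
    gcongr; linarith
  have h₆ : (p : ℝ) ^ 4 * G.value C / G.total ≤
      r * (v * p ^ 4 / G.total + η * p ^ 4) + η * p ^ 4 := by linarith
  rw [div_le_iff₀ hG] at h₆
  have h₇ : (r * (v * p ^ 4 / G.total + η * p ^ 4) + η * p ^ 4) * G.total =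
      p ^ 4 * (r * v + (r + 1) * η * G.total) := by field_simp; ring
  rw [h₇] at h₆
  exact le_of_mul_le_mul_left h₆ (by positivity)

end BlowUp

end CorrClust

/-! ### Correctness of the programs -/

namespace CorrClust

open Enc

/-! ### Prime search -/

theorem sum_map_range (n : ℕ) (f : ℕ → ℕ) :
    ((List.range n).map f).sum = ∑ i : Fin n, f i := by
  rw [Fin.sum_univ_eq_sum_range]
  rfl

theorem divisorCount_eq_zero {B p : ℕ} (hp : p < B) (h : divisorCount B p = 0) {d : ℕ}
    (hd : 1 < d) (hdp : d < p) : ¬ d ∣ p := by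
  intro hdvd
  rw [divisorCount, List.sum_eq_zero_iff] at h
  have := h _ (List.mem_map_of_mem (List.mem_range.2 (hdp.trans hp)))
  have h₁ : Nat.blt 1 d = true := by rw [Nat.blt_eq]; exact hd
  have h₂ : Nat.blt d p = true := by rw [Nat.blt_eq]; exact hdp
  have h₃ : Nat.beq (p % d) 0 = true := by rw [Nat.beq_eq]; exact Nat.mod_eq_zero_of_dvd hdvd
  rw [h₁, h₂, h₃] at this
  simp at this

theorem primeValue_of_prime (B : ℕ) {p : ℕ} (hp : p.Prime) : primeValue B p = p := by
  have : divisorCount B p = 0 := by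
    rw [divisorCount, List.sum_eq_zero_iff]
    intro x hx
    obtain ⟨d, -, rfl⟩ := List.mem_map.1 hx
    by_contra h
    have h' : (Nat.blt 1 d && Nat.blt d p && Nat.beq (p % d) 0) = true := by
      by_contra h'
      rw [Bool.not_eq_true] at h'
      rw [h'] at h
      exact h rfl
    rw [Bool.and_eq_true, Bool.and_eq_true, Nat.blt_eq, Nat.blt_eq, Nat.beq_eq] at h'
    obtain ⟨⟨h₁, h₂⟩, h₃⟩ := h'
    rcases (Nat.dvd_prime hp).1 (Nat.dvd_of_mod_eq_zero h₃) with h | h <;> omega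
  rw [primeValue, this]
  rfl

/-- Bertrand's postulate supplies a prime of score above `R`, so the maximal score exceeds `R` as
well. A nonzero score certifies the absence of nontrivial divisors. -/
theorem findPrime_spec {R : ℕ} (hR : 1 ≤ R) : (findPrime R).Prime ∧ R < findPrime R := by
  obtain ⟨p, hp, hRp, hpR⟩ := Nat.exists_prime_lt_and_le_two_mul R (by omega)
  have h₁ := le_best (primeValue (2 * R + 1)) 0 (List.range (2 * R + 1)) p
    (List.mem_cons_of_mem _ (List.mem_range.2 (by omega)))
  rw [primeValue_of_prime _ hp] at h₁
  change p ≤ primeValue (2 * R + 1) (findPrime R) at h₁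
  have h₂ := findPrime_le R
  rw [primeValue] at h₁
  cases h : Nat.beq (divisorCount (2 * R + 1) (findPrime R)) 0
  · rw [h, cond_false] at h₁; omega
  · rw [h, cond_true] at h₁
    rw [Nat.beq_eq] at h
    refine ⟨?_, by omega⟩
    rw [Nat.prime_def]
    refine ⟨by omega, fun d hd => ?_⟩
    by_contra hne
    push Not at hne
    have hd₀ : d ≠ 0 := by rintro rfl; rw [zero_dvd_iff] at hd; omega
    have hle := Nat.le_of_dvd (by omega) hd
    exact divisorCount_eq_zero (by omega) h (d := d) (by omega) (by omega) hd

/-! ### The matrix of a graph -/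

section

variable {n : ℕ} (G : WGraph n)

theorem length_mat : G.mat.length = n := by simp [WGraph.mat]

theorem entry_mat (i j : Fin n) : entry G.mat i j = ratTri (G.w i j) := by
  simp [entry, WGraph.mat]

theorem denProd_mat : denProd G.mat = ∏ i, ∏ j, (G.w i j).den := by
  simp [denProd, WGraph.mat, List.prod_ofFn, ratTri, Function.comp_def]

theorem denProd_pos : 0 < denProd G.mat := by
  rw [denProd_mat]
  exact Finset.prod_pos fun i _ => Finset.prod_pos fun j _ => (G.w i j).den_pos

theorem den_dvd_denProd (i j : Fin n) : (G.w i j).den ∣ denProd G.mat := by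
  rw [denProd_mat]
  exact (Finset.dvd_prod_of_mem (fun j => (G.w i j).den) (Finset.mem_univ j)).trans
    (Finset.dvd_prod_of_mem (fun i => ∏ j, (G.w i j).den) (Finset.mem_univ i))

theorem natAbs_num_div_den (q : ℚ) : (q.num.natAbs : ℝ) / q.den = |(q : ℝ)| := by
  rw [Rat.cast_def, abs_div, Nat.abs_cast, ← Int.cast_abs, Int.abs_eq_natAbs]
  rfl

/-- Multiplying by a common denominator makes all comparisons exact in natural numbers. The factor
cancels both in the comparison of scores and in the thresholds. -/
theorem absWeight_mat (i j : Fin n) :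
    (absWeight G.mat i j : ℝ) = denProd G.mat * |(G.w i j : ℝ)| := by
  rw [absWeight, entry_mat]
  have h : ((G.w i j).den : ℝ) ≠ 0 := by exact_mod_cast (G.w i j).den_ne_zero
  simp only [ratTri]
  rw [Nat.cast_mul, Nat.cast_div (den_dvd_denProd G i j) h, ← natAbs_num_div_den]
  ring

theorem totalWeight_mat : (totalWeight G.mat : ℝ) = denProd G.mat * G.total := by
  rw [totalWeight, length_mat]
  simp_rw [sum_map_range]
  push_cast
  simp_rw [absWeight_mat, ← Finset.mul_sum]
  rfl

/-- The clustering given by a list of labels. -/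
def listSetoid (n : ℕ) (L : List ℕ) : Setoid (Fin n) := Setoid.ker fun i : Fin n => L.getD i 0

theorem score_mat (L : List ℕ) :
    (score G.mat L : ℝ) = denProd G.mat * G.value (listSetoid n L) := by
  classical
  rw [score, length_mat]
  simp_rw [sum_map_range]
  push_cast
  rw [WGraph.value, Finset.mul_sum]
  refine Finset.sum_congr rfl fun i _ => ?_
  rw [Finset.mul_sum]
  refine Finset.sum_congr rfl fun j _ => ?_
  have h : (listSetoid n L).r i j ↔ L.getD i 0 = L.getD j 0 := Iff.rfl
  simp only [h, scoreAt, entry_mat]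
  have key : Nat.beq (ratTri (G.w i j)).1
      (bif Nat.beq (L.getD i 0) (L.getD j 0) then 0 else 1) = true ↔
      decide (L.getD i 0 = L.getD j 0) = decide (0 ≤ G.w i j) := by
    rw [Nat.beq_eq, ratTri]
    by_cases h₁ : L.getD i 0 = L.getD j 0
    · have : Nat.beq (L.getD i 0) (L.getD j 0) = true := by rw [Nat.beq_eq]; exact h₁
      rw [this]
      by_cases h₂ : G.w i j < 0
      · simp only [h₁, h₂, not_le.2 h₂]; simp
      · simp only [h₁, h₂, not_lt.1 h₂]; simp
    · have : Nat.beq (L.getD i 0) (L.getD j 0) = false := by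
        rw [← Bool.not_eq_true, Nat.beq_eq]; exact h₁
      rw [this]
      by_cases h₂ : G.w i j < 0
      · simp only [h₁, h₂, not_le.2 h₂]; simp
      · simp only [h₁, h₂, not_lt.1 h₂]; simp
  by_cases h₀ : decide (L.getD i 0 = L.getD j 0) = decide (0 ≤ G.w i j)
  · rw [key.2 h₀, if_pos h₀, cond_true, absWeight_mat]
  · rw [Bool.eq_false_iff.2 (mt key.1 h₀), if_neg h₀]
    simp

theorem value_le_of_score_le {L L' : List ℕ} (h : score G.mat L ≤ score G.mat L') :
    G.value (listSetoid n L) ≤ G.value (listSetoid n L') := by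
  have h' : (score G.mat L : ℝ) ≤ score G.mat L' := by exact_mod_cast h
  rw [score_mat, score_mat] at h'
  exact le_of_mul_le_mul_left h' (by exact_mod_cast denProd_pos G)

/-! ### The blow-up -/

/-- The thresholds used for the blow-up. -/
def WGraph.thr (p : ℕ) (a b : ℚ) (i j : Fin n) : ℕ :=
  threshold G.mat p (totalWeight G.mat) (if G.w i j < 0 then ratTri a else ratTri b) i j

theorem absWeight_comm (i j : Fin n) : absWeight G.mat i j = absWeight G.mat j i := by
  rw [absWeight, absWeight, entry_mat, entry_mat, G.symm]

theorem WGraph.thr_symm (p : ℕ) (a b : ℚ) (i j : Fin n) : G.thr p a b i j = G.thr p a b j i := by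
  rw [WGraph.thr, WGraph.thr, threshold, threshold, absWeight_comm, G.symm]

theorem WGraph.thr_self (p : ℕ) (a b : ℚ) (i : Fin n) : G.thr p a b i i = 0 := by
  rw [WGraph.thr, threshold, absWeight, entry_mat, G.loopless]
  simp [ratTri]

theorem ratTri_neg {a : ℚ} (ha : 0 < a) : ratTri (-a) = (1, (ratTri a).2) := by
  simp [ratTri, ha]

theorem ratTri_pos {b : ℚ} (hb : 0 < b) : ratTri b = (0, (ratTri b).2) := by
  simp [ratTri, hb.le]

theorem blowEntry_mat (p : ℕ) {a b : ℚ} (ha : 0 < a) (hb : 0 < b) (u v : Fin (n * (p * p))) :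
    blowEntry G.mat p (totalWeight G.mat) (ratTri a) (ratTri b) u v =
      ratTri ((G.blowUp p (G.thr p a b) (G.thr_symm p a b) (G.thr_self p a b) a b).w u v) := by
  have hblt : ∀ (s t : ℕ) (x y : Tri),
      (bif Nat.blt s t then x else y) = if s < t then x else y := by
    intro s t x y
    by_cases h : s < t
    · rw [if_pos h, show Nat.blt s t = true by rw [Nat.blt_eq]; exact h, cond_true]
    · rw [if_neg h, show Nat.blt s t = false by
        rw [← Bool.not_eq_true, Nat.blt_eq]; exact h, cond_false]
  have hbeq : ∀ x y : Tri, (bif Nat.beq (ratTri (G.w (blk u) (blk v))).1 1 then x else y) =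
      if G.w (blk u) (blk v) < 0 then x else y := by
    intro x y
    by_cases h : G.w (blk u) (blk v) < 0
    · simp only [ratTri, h, if_true]; rfl
    · simp only [ratTri, h, if_false]; rfl
  have he : entry G.mat (u / (p * p)) (v / (p * p)) = ratTri (G.w (blk u) (blk v)) :=
    entry_mat G (blk u) (blk v)
  have hu : (u : ℕ) / (p * p) = (blk u : ℕ) := rfl
  have hv : (v : ℕ) / (p * p) = (blk v : ℕ) := rfl
  have hinc : ((u / p % p) * (v / p % p) + u % p + v % p) % p = incNat p u v := rfl
  rw [blowEntry, he]
  simp only [hblt, hbeq, hinc, hu, hv]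
  change (if incNat p u v < G.thr p a b (blk u) (blk v) then _ else _) =
    ratTri (if incNat p u v < G.thr p a b (blk u) (blk v) then _ else _)
  by_cases h : incNat p u v < G.thr p a b (blk u) (blk v)
  · rw [if_pos h, if_pos h]
    by_cases h₁ : G.w (blk u) (blk v) < 0
    · rw [if_pos h₁, if_pos h₁, ratTri_neg ha]
    · rw [if_neg h₁, if_neg h₁]
      exact (ratTri_pos hb).symm
  · rw [if_neg h, if_neg h]
    simp [ratTri]

theorem blow_mat (α β : ℕ → ℚ) (hα : ∀ m, 0 < α m) (hβ : ∀ m, 0 < β m) (K k : ℕ) :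
    blow α β K k G.mat = (n * (side K k n * side K k n),
      (G.blowUp (side K k n) _ (G.thr_symm (side K k n) (α (blowSize K k n)) (β (blowSize K k n)))
        (G.thr_self _ _ _) (α (blowSize K k n)) (β (blowSize K k n))).mat) := by
  rw [blow, length_mat]
  refine Prod.ext rfl ?_
  change _ = List.ofFn _
  refine List.ext_getElem (by simp [blowSize]) fun u hu hu' => ?_
  simp only [List.getElem_map, List.getElem_range, List.getElem_ofFn]
  refine List.ext_getElem (by simp [blowSize]) fun v hv hv' => ?_
  simp only [List.getElem_map, List.getElem_range, List.getElem_ofFn]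
  exact blowEntry_mat G (side K k n) (hα _) (hβ _) ⟨u, by simpa using hu'⟩ ⟨v, by simpa using hv'⟩

theorem WGraph.isInstance_blowUp (p : ℕ) (T : Fin n → Fin n → ℕ) (hT : ∀ i j, T i j = T j i)
    (hT₀ : ∀ i, T i i = 0) (a b : ℕ → ℚ) :
    (G.blowUp p T hT hT₀ (a (n * (p * p))) (b (n * (p * p)))).IsInstance
      fun m => {-a m, 0, b m} := by
  intro u v _
  simp only [WGraph.blowUp]
  split
  · split <;> simp
  · simp

/-- The threshold is `⌊ρ p / g⌋` with `ρ = |w i j| / total`, so these are the two inequalities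
defining the floor, after the common denominators are cancelled. -/
theorem thr_bounds (p : ℕ) {a b : ℚ} (ha : 0 < a) (hb : 0 < b) (hG : 0 < G.total) (i j : Fin n) :
    ((if G.w i j < 0 then a else b : ℚ) : ℝ) * G.thr p a b i j ≤ |(G.w i j : ℝ)| / G.total * p ∧
    |(G.w i j : ℝ)| / G.total * p ≤ ((if G.w i j < 0 then a else b : ℚ) : ℝ) * G.thr p a b i j
      + ((if G.w i j < 0 then a else b : ℚ) : ℝ) := by
  have hg : ratTri (if G.w i j < 0 then a else b) =
      if G.w i j < 0 then ratTri a else ratTri b := by split <;> rfl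
  have hg₀ : (0 : ℚ) < if G.w i j < 0 then a else b := by split <;> assumption
  rw [WGraph.thr, ← hg]
  generalize (if G.w i j < 0 then a else b) = g at hg₀
  have hg₁ : (0 : ℝ) < g := by exact_mod_cast hg₀
  have hden : (0 : ℝ) < g.den := by exact_mod_cast g.den_pos
  have hnum : (g.num.natAbs : ℝ) = g * g.den := by
    rw [← div_eq_iff hden.ne', natAbs_num_div_den, abs_of_pos hg₁]
  have hD : (0 : ℝ) < denProd G.mat := by exact_mod_cast denProd_pos G
  have hpos : 0 < totalWeight G.mat * g.num.natAbs := by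
    have : (0 : ℝ) < totalWeight G.mat * g.num.natAbs := by
      rw [totalWeight_mat, hnum]; positivity
    exact_mod_cast this
  set T := threshold G.mat p (totalWeight G.mat) (ratTri g) i j with hT
  have h₁ : T * (totalWeight G.mat * g.num.natAbs) ≤ absWeight G.mat i j * p * g.den :=
    Nat.div_mul_le_self _ _
  have h₂ : absWeight G.mat i j * p * g.den < (T + 1) * (totalWeight G.mat * g.num.natAbs) := by
    have := Nat.lt_div_mul_add (a := absWeight G.mat i j * p * g.den) hpos
    rw [add_mul, one_mul]
    exact this
  have h₁' : (T : ℝ) * (totalWeight G.mat * g.num.natAbs) ≤ absWeight G.mat i j * p * g.den := by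
    exact_mod_cast h₁
  have h₂' : (absWeight G.mat i j : ℝ) * p * g.den ≤
      (T + 1) * (totalWeight G.mat * g.num.natAbs) := by
    exact_mod_cast h₂.le
  rw [totalWeight_mat, absWeight_mat, hnum] at h₁' h₂'
  have hc : 0 < (denProd G.mat : ℝ) * g.den := by positivity
  constructor
  · rw [div_mul_eq_mul_div, le_div_iff₀ hG]
    refine le_of_mul_le_mul_left ?_ hc
    linarith
  · rw [div_mul_eq_mul_div, div_le_iff₀ hG]
    refine le_of_mul_le_mul_left ?_ hc
    linarith

/-- A density cannot exceed `1`; here it matters that both weights are at least `1`, and that the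
weights are normalized by `total`. -/
theorem thr_le {p : ℕ} {a b : ℚ} (ha : 1 ≤ a) (hb : 1 ≤ b) (hG : 0 < G.total) (i j : Fin n) :
    G.thr p a b i j ≤ p := by
  have h := (thr_bounds G p (zero_lt_one.trans_le ha) (zero_lt_one.trans_le hb) hG i j).1
  have h₁ : (1 : ℝ) ≤ ((if G.w i j < 0 then a else b : ℚ) : ℝ) := by
    have : (1 : ℚ) ≤ if G.w i j < 0 then a else b := by split <;> assumption
    exact_mod_cast this
  have h₂ : |(G.w i j : ℝ)| / G.total ≤ 1 := div_le_one_of_le₀ (G.abs_w_le_total i j) hG.le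
  have h₃ : (G.thr p a b i j : ℝ) ≤ p := by
    calc (G.thr p a b i j : ℝ) = 1 * G.thr p a b i j := (one_mul _).symm
      _ ≤ _ := by gcongr
      _ ≤ _ := h
      _ ≤ 1 * p := by gcongr
      _ = p := one_mul _
  exact_mod_cast h₃

/-! ### Labels -/

theorem toLabels_encLabels (c : Fin n → ℕ) : toLabels (encLabels c) = List.ofFn c := by
  have : ∀ l : List ℕ, toLabels (encList (l.map Data.num)) = l := by
    intro l
    induction l with
    | nil => rfl
    | cons a l ih => simp only [List.map_cons, encList, toLabels, toNum, ih]
  rw [encLabels, ← this (List.ofFn c), List.map_ofFn]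
  rfl

theorem enc_normalize (L : List ℕ) :
    enc (normalize n L) = encLabels fun i : Fin n => L.getD i 0 := by
  have : normalize n L = List.ofFn fun i : Fin n => L.getD i 0 := by
    refine List.ext_getElem (by simp [normalize]) fun i hi hi' => ?_
    simp [normalize]
  rw [this, encLabels]
  change encList ((List.ofFn fun i : Fin n => L.getD i 0).map Data.num) = _
  rw [List.map_ofFn]
  rfl

theorem normalize_coins {s t : ℕ} (h : s ≤ t) (r : Fin t → Bool) :
    enc (normalize s (List.ofFn fun i => (r i).toNat)) = encCoins fun i => r (Fin.castLE h i) := by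
  rw [enc_normalize, encLabels, encCoins]
  congr 2
  funext i
  simp [List.getD_eq_getElem?_getD, i.2.trans_le h]
  rfl

theorem getD_candidate {p : ℕ} [Fact p.Prime] (c : Fin (n * (p * p)) → ℕ)
    (q : (ZMod p × ZMod p) × (ZMod p × ZMod p)) :
    ∃ q' < p ^ 4, listSetoid n (candidate n p (List.ofFn c) q') = Setoid.ker (repLabels c q) := by
  have hp : 0 < p := (Fact.out : p.Prime).pos
  obtain ⟨⟨b₁, a₁⟩, b₂, a₂⟩ := q
  have hb₁ := b₁.val_lt
  have ha₁ := a₁.val_lt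
  have hb₂ := b₂.val_lt
  have ha₂ := a₂.val_lt
  -- The base-`p` digits are, from the lowest, intercept and slope of the first coordinate, then of
  -- the second, as `candidate` decodes them.
  refine ⟨a₁.val + p * (b₁.val + p * (a₂.val + p * b₂.val)), ?_, ?_⟩
  · have h₁ : a₂.val + p * b₂.val < p * p := by nlinarith
    have h₂ : b₁.val + p * (a₂.val + p * b₂.val) < p * (p * p) := by nlinarith
    have h₃ : a₁.val + p * (b₁.val + p * (a₂.val + p * b₂.val)) < p * (p * (p * p)) := by nlinarith
    calc _ < _ := h₃
      _ = p ^ 4 := by ring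
  · unfold listSetoid
    congr 1
    funext i
    simp only [candidate, ← Nat.div_div_eq_div_mul, Nat.add_mul_div_left _ _ hp,
      Nat.div_eq_of_lt ha₁, Nat.div_eq_of_lt hb₁, Nat.div_eq_of_lt ha₂, zero_add,
      Nat.add_mul_mod_self_left, Nat.mod_eq_of_lt ha₁, Nat.mod_eq_of_lt hb₁, Nat.mod_eq_of_lt ha₂,
      Nat.mod_eq_of_lt hb₂]
    have hval : ∀ a b : ZMod p, (a.val + b.val * i) % p = (((i : ℕ) : ZMod p) * b + a).val := by
      intro a b
      rw [← ZMod.val_natCast]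
      push_cast
      simp only [ZMod.natCast_val, ZMod.cast_id', id_eq]
      congr 1
      ring
    rw [List.getD_eq_getElem _ _ (by simp), List.getElem_map, List.getElem_range, hval, hval,
      repLabels]
    have hlt := (vtx i (((i : ℕ) : ZMod p) * b₁ + a₁, ((i : ℕ) : ZMod p) * b₂ + a₂)).2
    rw [List.getD_eq_getElem _ _ (by simpa [vtx] using hlt), List.getElem_ofFn]
    rfl

/-- All lists of `N` labels less than `N`. -/
noncomputable def bruteLists (N : ℕ) : List (List ℕ) :=
  (Finset.univ : Finset (Fin N → Fin N)).toList.map fun f => List.ofFn fun i => (f i : ℕ)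

/-- Each vertex is labelled by a chosen representative of its class. Entries beyond the first `n`
are filler and are never read, so one fixed table serves all `n ≤ N`. -/
theorem exists_bruteLists {N : ℕ} (hN : n ≤ N) (C : Setoid (Fin n)) :
    ∃ L ∈ bruteLists N, listSetoid n L = C := by
  let f : Fin N → Fin N := fun i =>
    if h : (i : ℕ) < n then Fin.castLE hN (Quotient.mk C ⟨i, h⟩).out else i
  refine ⟨_, List.mem_map_of_mem (Finset.mem_toList.2 (Finset.mem_univ f)), ?_⟩
  have hf : ∀ i : Fin n, (List.ofFn fun i => (f i : ℕ)).getD i 0 =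
      ((Quotient.mk C i).out : ℕ) := by
    intro i
    rw [List.getD_eq_getElem _ _ (by simpa using i.2.trans_le hN), List.getElem_ofFn]
    simp [f]
  ext i j
  change (List.ofFn fun i => (f i : ℕ)).getD i 0 = (List.ofFn fun i => (f i : ℕ)).getD j 0 ↔ _
  rw [hf, hf, Fin.val_inj, Quotient.out_inj]
  exact Quotient.eq

theorem listSetoid_nil : listSetoid n [] = ⊤ := by
  ext i j
  exact iff_of_true rfl trivial

theorem listSetoid_range : listSetoid n (List.range n) = ⊥ := by
  ext i j
  change (List.range n).getD i 0 = (List.range n).getD j 0 ↔ i = j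
  simp [Fin.val_inj]

section Best

variable (K k : ℕ) (brute : List (List ℕ)) (L : List ℕ)

theorem value_le_bestLabels {L' : List ℕ} (h : L' ∈ List.range n :: [] :: brute ∨
    ∃ q < side K k n ^ 4, L' = candidate n (side K k n) L q) :
    G.value (listSetoid n L') ≤ G.value (listSetoid n (bestLabels K k brute G.mat L)) := by
  refine value_le_of_score_le G ?_
  rw [bestLabels, length_mat]
  rcases h with h | ⟨q, hq, rfl⟩
  · exact (le_best (score G.mat) _ _ _ h).trans
      (le_best (score G.mat) _ _ _ List.mem_cons_self)
  · exact le_best (score G.mat) _ _ _ (List.mem_cons_of_mem _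
      (List.mem_map_of_mem (List.mem_range.2 hq)))

theorem total_le_bestLabels :
    G.total ≤ 2 * G.value (listSetoid n (bestLabels K k brute G.mat L)) := by
  have h₁ := value_le_bestLabels G K k brute L (L' := []) (by simp)
  have h₂ := value_le_bestLabels G K k brute L (L' := List.range n) (by simp)
  rw [listSetoid_nil] at h₁
  rw [listSetoid_range] at h₂
  have := G.value_top_add_value_bot
  linarith

end Best

end

end CorrClust

/-! ### Choice of parameters and assembly of the algorithm -/

namespace CorrClust

open Enc

/-- A nonincreasing factor only improves on the larger graph. A nondecreasing one either reaches
`2`, where trivial clusterings are good enough, or is bounded and comes within `ε / 2` of its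
supremum. -/
theorem exists_factor_bound {lam : ℕ → ℝ} (hlam : Monotone lam ∨ Antitone lam) {ε : ℝ}
    (hε : 0 < ε) : ∃ (N : ℕ) (Λ : ℝ), ∀ n ≥ N, ∀ m ≥ n,
      2 ≤ lam n ∨ (lam m ≤ lam n + ε / 2 ∧ lam m ≤ Λ) := by
  rcases hlam with h | h
  · by_cases h₂ : ∃ N, 2 ≤ lam N
    · obtain ⟨N, hN⟩ := h₂
      exact ⟨N, 0, fun n hn m _ => .inl (hN.trans (h hn))⟩
    · push Not at h₂
      have hbdd : BddAbove (Set.range lam) := ⟨2, by rintro _ ⟨m, rfl⟩; exact (h₂ m).le⟩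
      obtain ⟨N, hN⟩ := exists_lt_of_lt_ciSup (show (⨆ m, lam m) - ε / 2 < ⨆ m, lam m by linarith)
      refine ⟨N, 2, fun n hn m _ => .inr ⟨?_, (h₂ m).le⟩⟩
      have h₃ := le_ciSup hbdd m
      have h₄ := h hn
      linarith
  · exact ⟨0, lam 0, fun n _ m hm => .inr
      ⟨(h hm).trans (by linarith), h (Nat.zero_le m)⟩⟩

theorem side_spec {K : ℕ} (hK : 1 ≤ K) (k n : ℕ) :
    (side K k n).Prime ∧ K * (n + 1) ^ k < side K k n :=
  findPrime_spec (Nat.mul_pos hK (by positivity))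

/-- With `N = n + 1`, the requirement `C N p^(1-2δ) ≤ (η / N²)² p` reads `C N⁵ / η² ≤ p^(2δ)`. Since
`p > K N^k`, it suffices that `2δk ≥ 5` and `K^(2δ) ≥ C / η²`. The summand `M` in `K` brings the
blow-up into the range where the asymptotic bound holds. -/
theorem exists_side_large {γ : ℕ → ℝ} {δ : ℝ} (hδ₀ : 0 < δ) (hδ₁ : δ ≤ 1 / 2)
    (hγ : γ =O[Filter.atTop] fun m : ℕ => (m : ℝ) ^ (1 / 2 - δ)) {η : ℝ} (hη : 0 < η) :
    ∃ K k : ℕ, 1 ≤ K ∧ 1 ≤ k ∧ ∀ n ≥ 1,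
      γ (blowSize K k n) ≤ (η / ((n : ℝ) + 1) ^ 2) ^ 2 * side K k n := by
  obtain ⟨C, hC₀, hC⟩ := hγ.exists_pos
  rw [Asymptotics.IsBigOWith, Filter.eventually_atTop] at hC
  obtain ⟨M, hM⟩ := hC
  obtain ⟨k, hk⟩ := exists_nat_ge (5 / (2 * δ))
  obtain ⟨K₀, hK₀⟩ := exists_nat_ge ((C / η ^ 2) ^ (1 / (2 * δ)))
  refine ⟨K₀ + M + 1, k, by omega, ?_, fun n hn => ?_⟩
  · have : (0 : ℝ) < k := lt_of_lt_of_le (by positivity) hk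
    exact_mod_cast this
  obtain ⟨hp, hlt⟩ := side_spec (K := K₀ + M + 1) (by omega) k n
  rw [blowSize]
  generalize side (K₀ + M + 1) k n = p at hp hlt
  have hpM : M ≤ n * (p * p) := by
    have h₁ : 1 ≤ (n + 1) ^ k := Nat.one_le_pow _ _ (by omega)
    have h₂ : K₀ + M + 1 ≤ (K₀ + M + 1) * (n + 1) ^ k := Nat.le_mul_of_pos_right _ h₁
    have h₃ : p ≤ p * p := Nat.le_mul_of_pos_right _ hp.pos
    have h₄ : p * p ≤ n * (p * p) := Nat.le_mul_of_pos_left _ hn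
    omega
  have hbound := hM _ hpM
  have hp₀ : (0 : ℝ) < p := by exact_mod_cast hp.pos
  set N : ℝ := (n : ℝ) + 1 with hN
  have hN₁ : 1 ≤ N := by rw [hN]; linarith [Nat.cast_nonneg (α := ℝ) n]
  have hN₀ : 0 < N := by linarith
  have hpow : ((n * (p * p) : ℕ) : ℝ) ^ (1 / 2 - δ) ≤ N * (p / (p : ℝ) ^ (2 * δ)) := by
    push_cast
    rw [Real.mul_rpow (by positivity) (by positivity)]
    have h₁ : (n : ℝ) ^ (1 / 2 - δ) ≤ N := by
      calc (n : ℝ) ^ (1 / 2 - δ) ≤ N ^ (1 / 2 - δ) :=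
            Real.rpow_le_rpow (by positivity) (by linarith) (by linarith)
        _ ≤ N ^ (1 : ℝ) := Real.rpow_le_rpow_of_exponent_le hN₁ (by linarith)
        _ = N := Real.rpow_one N
    have h₂ : ((p : ℝ) * p) ^ (1 / 2 - δ) = p / (p : ℝ) ^ (2 * δ) := by
      rw [Real.mul_rpow hp₀.le hp₀.le, ← Real.rpow_add hp₀,
        show (1 / 2 - δ) + (1 / 2 - δ) = 1 - 2 * δ by ring, Real.rpow_sub hp₀, Real.rpow_one]
    rw [h₂]
    gcongr
  have hK : C / η ^ 2 ≤ ((K₀ + M + 1 : ℕ) : ℝ) ^ (2 * δ) := by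
    calc C / η ^ 2 = ((C / η ^ 2) ^ (1 / (2 * δ))) ^ (2 * δ) := by
          rw [← Real.rpow_mul (by positivity), one_div, inv_mul_cancel₀ (by positivity),
            Real.rpow_one]
      _ ≤ ((K₀ + M + 1 : ℕ) : ℝ) ^ (2 * δ) := by
          refine Real.rpow_le_rpow (by positivity) (hK₀.trans ?_) (by positivity)
          push_cast
          linarith [Nat.cast_nonneg (α := ℝ) M]
  have hpδ : C / η ^ 2 * N ^ 5 ≤ (p : ℝ) ^ (2 * δ) := by
    have h₁ : ((K₀ + M + 1 : ℕ) : ℝ) * N ^ k ≤ p := by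
      rw [hN]; exact_mod_cast hlt.le
    calc C / η ^ 2 * N ^ 5 ≤ ((K₀ + M + 1 : ℕ) : ℝ) ^ (2 * δ) * (N ^ k) ^ (2 * δ) := by
          refine mul_le_mul hK ?_ (by positivity) (by positivity)
          rw [← Real.rpow_natCast N k, ← Real.rpow_mul hN₀.le, ← Real.rpow_natCast N 5]
          refine Real.rpow_le_rpow_of_exponent_le hN₁ ?_
          rw [div_le_iff₀ (by positivity)] at hk
          exact_mod_cast hk
      _ = (((K₀ + M + 1 : ℕ) : ℝ) * N ^ k) ^ (2 * δ) :=
          (Real.mul_rpow (by positivity) (by positivity)).symm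
      _ ≤ (p : ℝ) ^ (2 * δ) := Real.rpow_le_rpow (by positivity) h₁ (by positivity)
  calc γ (n * (p * p)) ≤ ‖γ (n * (p * p))‖ := Real.le_norm_self _
    _ ≤ C * ‖((n * (p * p) : ℕ) : ℝ) ^ (1 / 2 - δ)‖ := hbound
    _ = C * ((n * (p * p) : ℕ) : ℝ) ^ (1 / 2 - δ) := by
        rw [Real.norm_of_nonneg (by positivity)]
    _ ≤ C * (N * (p / (p : ℝ) ^ (2 * δ))) := by gcongr
    _ ≤ C * (N * (p / (C / η ^ 2 * N ^ 5))) := by gcongr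
    _ = (η / N ^ 2) ^ 2 * p := by field_simp

/-- The best of the candidate clusterings obtained from an approximately optimal clustering of
the blow-up is approximately optimal. -/
theorem isApprox_bestLabels {n : ℕ} (G : WGraph n) {a b : ℚ} (ha : 1 ≤ a) (hb : 1 ≤ b)
    {K k N : ℕ} (hK : 1 ≤ K) (hk : 1 ≤ k) {l r ε Λ η : ℝ} (hl : 1 ≤ l) (hr : 1 ≤ r) (hε : 0 < ε)
    (hη : 0 < η) (hη₁ : η ≤ 1) (hηΛ : (Λ + 1) * (2 * η) ≤ ε / 4)
    (hab : 1 ≤ n → ((a : ℝ) + b) ≤ (η / ((n : ℝ) + 1) ^ 2) ^ 2 * side K k n)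
    (hlr : N ≤ n → 2 ≤ l ∨ (r ≤ l + ε / 2 ∧ r ≤ Λ)) (c : Fin (n * (side K k n * side K k n)) → ℕ)
    (hc : (G.blowUp (side K k n) _ (G.thr_symm (side K k n) a b) (G.thr_self _ a b) a b).IsApprox r
      (Setoid.ker c)) :
    G.IsApprox (l + ε) (listSetoid n (bestLabels K k (bruteLists N) G.mat (List.ofFn c))) := by
  rw [WGraph.isApprox_iff]
  intro C
  set X := G.value (listSetoid n (bestLabels K k (bruteLists N) G.mat (List.ofFn c))) with hX
  have hX₀ : 0 ≤ X := G.value_nonneg _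
  have hXtot : G.total ≤ 2 * X := total_le_bestLabels G K k (bruteLists N) (List.ofFn c)
  have hCtot := G.value_le_total C
  -- Small graphs are solved by the table; if `l ≥ 2`, or if all weights vanish, the trivial
  -- clusterings suffice. Only the remaining case uses the blow-up.
  rcases lt_or_ge n N with hn | hn
  · obtain ⟨L, hL, rfl⟩ := exists_bruteLists hn.le C
    have := value_le_bestLabels G K k (bruteLists N) (List.ofFn c) (L' := L)
      (.inl (by simp [hL]))
    nlinarith
  rcases hlr hn with h₂ | ⟨hrl, hrΛ⟩
  · nlinarith
  rcases le_or_gt G.total 0 with h₀ | h₀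
  · nlinarith
  have hn₁ : 1 ≤ n := by
    rcases Nat.eq_zero_or_pos n with rfl | h
    · simp [WGraph.total] at h₀
    · exact h
  obtain ⟨hp, hlt⟩ := side_spec hK k n
  have : Fact (side K k n).Prime := ⟨hp⟩
  have hnp : n ≤ side K k n := by
    have h₁ : n + 1 ≤ (n + 1) ^ k := Nat.le_self_pow (by omega) _
    have h₂ : (n + 1) ^ k ≤ K * (n + 1) ^ k := Nat.le_mul_of_pos_left _ hK
    omega
  have ha₀ : (0 : ℝ) < a := by exact_mod_cast zero_lt_one.trans_le ha
  have hb₀ : (0 : ℝ) < b := by exact_mod_cast zero_lt_one.trans_le hb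
  have hab' := hab hn₁
  have hn₀ : (0 : ℝ) ≤ n := Nat.cast_nonneg n
  have he₁ : η / ((n : ℝ) + 1) ^ 2 ≤ 1 := by
    rw [div_le_one (by positivity)]
    nlinarith
  have hest := G.abs_value_blowUp_sub_le (p := side K k n) h₀ (G.thr_symm _ a b) (G.thr_self _ a b)
    (zero_lt_one.trans_le ha) (zero_lt_one.trans_le hb) (thr_le G ha hb h₀)
    (e := η / ((n : ℝ) + 1) ^ 2) (by positivity) he₁
    (fun i j => (thr_bounds G _ (zero_lt_one.trans_le ha) (zero_lt_one.trans_le hb) h₀ i j).1)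
    (fun i j => (thr_bounds G _ (zero_lt_one.trans_le ha) (zero_lt_one.trans_le hb) h₀ i j).2)
    (by linarith) (by linarith)
  have hη₂ : (n : ℝ) ^ 2 * (2 * (η / ((n : ℝ) + 1) ^ 2)) ≤ 2 * η := by
    have : (n : ℝ) ^ 2 * (2 * (η / ((n : ℝ) + 1) ^ 2)) =
        2 * η * ((n : ℝ) ^ 2 / ((n : ℝ) + 1) ^ 2) := by ring
    rw [this]
    refine mul_le_of_le_one_right (by positivity) (div_le_one_of_le₀ (by gcongr; linarith)
      (by positivity))
  obtain ⟨q, hq⟩ := G.exists_repLabels hnp h₀ _ (η := 2 * η) (zero_le_one.trans hr)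
    (fun C => (hest C).trans (by rw [← mul_assoc]; gcongr)) c hc
  obtain ⟨q', hq', hcand⟩ := getD_candidate c q
  have hq₁ := value_le_bestLabels G K k (bruteLists N) (List.ofFn c)
    (.inr ⟨q', hq', rfl⟩)
  rw [hcand, ← hX] at hq₁
  -- Half of `ε` pays for the passage from `r` to `l`. The other half pays for the additive error,
  -- via `total ≤ 2 * X`.
  calc G.value C ≤ r * G.value (Setoid.ker (repLabels c q)) + (r + 1) * (2 * η) * G.total := hq C
    _ ≤ r * X + (Λ + 1) * (2 * η) * G.total := by gcongr
    _ ≤ (l + ε / 2) * X + ε / 4 * (2 * X) := by gcongr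
    _ = (l + ε) * X := by ring

/-- Surplus coins do no harm: every successful string of length `s` has `2 ^ (t - s)` successful
extensions. -/
theorem card_coins_le {s t : ℕ} (h : s ≤ t) (P : (Fin s → Bool) → Prop) (Q : (Fin t → Bool) → Prop)
    (hPQ : ∀ r : Fin t → Bool, P (fun i => r (Fin.castLE h i)) → Q r) :
    (Nat.card {r // P r} : ℝ) / 2 ^ s ≤ (Nat.card {r // Q r} : ℝ) / 2 ^ t := by
  obtain ⟨d, rfl⟩ := Nat.exists_eq_add_of_le h
  let f : {r // P r} × (Fin d → Bool) → {r // Q r} := fun z =>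
    ⟨Fin.append z.1.1 z.2, hPQ _ (by
      have : (fun i => Fin.append z.1.1 z.2 (Fin.castLE h i)) = z.1.1 := by
        funext i; exact Fin.append_left z.1.1 z.2 i
      rw [this]
      exact z.1.2)⟩
  have hf : Function.Injective f := by
    rintro ⟨⟨r, hr⟩, u⟩ ⟨⟨r', hr'⟩, u'⟩ hz
    have := (Fin.appendEquiv s d).injective (a₁ := (r, u)) (a₂ := (r', u')) (congrArg Subtype.val hz)
    simp only [Prod.mk.injEq] at this
    obtain ⟨rfl, rfl⟩ := this
    rfl
  have hcard := Nat.card_le_card_of_injective f hf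
  rw [Nat.card_prod, show Nat.card (Fin d → Bool) = 2 ^ d by simp] at hcard
  rw [div_le_div_iff₀ (by positivity) (by positivity), pow_add]
  have : (Nat.card {r // P r} : ℝ) * 2 ^ d ≤ Nat.card {r // Q r} := by exact_mod_cast hcard
  calc (Nat.card {r // P r} : ℝ) * (2 ^ s * 2 ^ d) = Nat.card {r // P r} * 2 ^ d * 2 ^ s := by ring
    _ ≤ _ := by gcongr

theorem enc_input {n : ℕ} (G : WGraph n) {t : ℕ} (r : Fin t → Bool) :
    enc ((n, G.mat), List.ofFn fun i => (r i).toNat) = .pair G.enc (encCoins r) := by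
  change Data.pair (enc (n, G.mat)) (encList ((List.ofFn fun i => (r i).toNat).map Data.num)) = _
  rw [enc_mat, List.map_ofFn]
  rfl

theorem sz_input_le {n : ℕ} (G : WGraph n) {t : ℕ} (r : Fin t → Bool) :
    sz ((n, G.mat), List.ofFn fun i => (r i).toNat) ≤ G.enc.size + (3 * t + 1) + 1 := by
  rw [sz_prod]
  have h₁ : sz (n, G.mat) = G.enc.size := congrArg Data.size (enc_mat G)
  -- A coin has size at most `2`, and its list cell adds `1`.
  have h₂ := sz_list_le (l := List.ofFn fun i => (r i).toNat) (B := 2) (by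
    intro a ha
    obtain ⟨i, rfl⟩ := List.mem_ofFn.1 ha
    exact (PolyTime.sz_nat_le _).trans (by have := Bool.toNat_le (r i); omega))
  rw [List.length_ofFn] at h₂
  omega

/-- Approximation algorithms for `{-α, 0, β}`-MaxAgree carry over to arbitrary weights. -/
theorem randPolyTimeApprox_of_restricted (S : ℕ → Set ℚ) {α β : ℕ → ℚ} (hα : ∀ m, 1 ≤ α m)
    (hβ : ∀ m, 1 ≤ β m) (hαc : PolyTimeComputable α) (hβc : PolyTimeComputable β) {δ : ℝ}
    (hδ₀ : 0 < δ) (hδ₁ : δ ≤ 1 / 2)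
    (hαβ : (fun m : ℕ => ((α m : ℝ) + (β m : ℝ))) =O[Filter.atTop]
      fun m : ℕ => (m : ℝ) ^ (1 / 2 - δ))
    {lam : ℕ → ℝ} (hlam₁ : ∀ m, 1 ≤ lam m) (hlam : Monotone lam ∨ Antitone lam)
    (hA : RandPolyTimeApprox (fun m => {-α m, 0, β m}) lam) {ε : ℝ} (hε : 0 < ε) :
    RandPolyTimeApprox S (fun n => lam n + ε) := by
  obtain ⟨N, Λ', hN⟩ := exists_factor_bound hlam hε
  obtain ⟨Λ, hΛ, hΛ₀⟩ : ∃ Λ, Λ' ≤ Λ ∧ 0 ≤ Λ := ⟨max Λ' 0, le_max_left _ _, le_max_right _ _⟩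
  obtain ⟨η, hη, hη₁, hηΛ⟩ : ∃ η : ℝ, 0 < η ∧ η ≤ 1 ∧ (Λ + 1) * (2 * η) ≤ ε / 4 := by
    refine ⟨min 1 (ε / (8 * (Λ + 1))), by positivity, min_le_left _ _, ?_⟩
    calc (Λ + 1) * (2 * min 1 (ε / (8 * (Λ + 1)))) ≤ (Λ + 1) * (2 * (ε / (8 * (Λ + 1)))) := by
          gcongr
          exact min_le_right _ _
      _ = ε / 4 := by field_simp; norm_num
  obtain ⟨K, k, hK, hk, hside⟩ := exists_side_large hδ₀ hδ₁ hαβ hη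
  obtain ⟨A, pA, qA, hA⟩ := hA
  obtain ⟨pre, pp, hpre⟩ := PolyTime.preprocess K k qA hαc hβc
  obtain ⟨post, po, hpost⟩ := PolyTime.postprocess K k (bruteLists N)
  obtain ⟨Q, hQ⟩ := coinCount_polyBounded K k qA hαc hβc
  -- `I` bounds the size of the input with its coins, `Y` the cost of `A` on the blow-up.
  let I : Polynomial ℕ := .X + (3 * Q + 1) + 1
  let Y : Polynomial ℕ := pA.comp (pp.comp I)
  -- The original input is kept beside the output of `A`, because the postprocessing evaluates the
  -- candidates on `G`. The polynomial `Q` bounds the coins needed on the blow-up; only a prefix of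
  -- the flips is used.
  refine ⟨.comp post (.pair .id (.comp A pre)),
    ((I + 1) + (pp.comp I + Y + 1) + 1) + po.comp (I + Y + 1) + 1, Q, fun n G _ => ?_⟩
  have hα₀ : ∀ m, 0 < α m := fun m => zero_lt_one.trans_le (hα m)
  have hβ₀ : ∀ m, 0 < β m := fun m => zero_lt_one.trans_le (hβ m)
  have hblow := blow_mat G α β hα₀ hβ₀ K k
  set a := α (blowSize K k n) with ha
  set b := β (blowSize K k n) with hb
  set G' := G.blowUp (side K k n) _ (G.thr_symm (side K k n) a b) (G.thr_self _ a b) a b with hG'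
  have hsz : sz (blow α β K k G.mat) = G'.enc.size := by
    rw [hblow]; exact congrArg Data.size (enc_mat G')
  have hcount : coinCount α β K k qA G.mat = qA.eval G'.enc.size := by rw [coinCount, hsz]
  have hle : qA.eval G'.enc.size ≤ Q.eval G.enc.size := by
    rw [← hcount, ← congrArg Data.size (enc_mat G)]
    exact hQ (n, G.mat)
  obtain ⟨hrun, hprob⟩ := hA _ G' (G.isInstance_blowUp _ _ _ _ α β)
  have hprep : ∀ r : Fin (Q.eval G.enc.size) → Bool,
      enc (preprocess α β K k qA ((n, G.mat), List.ofFn fun i => (r i).toNat)) =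
        .pair G'.enc (encCoins fun i => r (Fin.castLE hle i)) := by
    intro r
    rw [← normalize_coins hle, ← hcount, ← enc_mat G', ← hblow]
    rfl
  have hfull : ∀ (r : Fin (Q.eval G.enc.size) → Bool) (y : Data) (t : ℕ),
      Runs A (.pair G'.enc (encCoins fun i => r (Fin.castLE hle i))) y t →
      ∃ u, Runs (.comp post (.pair .id (.comp A pre))) (.pair G.enc (encCoins r))
        (encLabels fun i : Fin n => (bestLabels K k (bruteLists N) G.mat (toLabels y)).getD i 0) u ∧
        (t ≤ pA.eval G'.enc.size → u ≤ (((I + 1) + (pp.comp I + Y + 1) + 1) +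
          po.comp (I + Y + 1) + 1).eval G.enc.size) := by
    intro r y t hy
    set x : (ℕ × Mat) × List ℕ := ((n, G.mat), List.ofFn fun i => (r i).toNat) with hx
    obtain ⟨t₁, ht₁, h₁⟩ := hpre x
    obtain ⟨t₂, ht₂, h₂⟩ := hpost (x, y)
    rw [hprep r] at h₁
    have hout : enc (postprocess K k (bruteLists N) (x, y)) = encLabels fun i : Fin n =>
        (bestLabels K k (bruteLists N) G.mat (toLabels y)).getD i 0 := by
      rw [← enc_normalize]
      change enc (normalize G.mat.length _) = _
      rw [length_mat]
    rw [hout] at h₂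
    rw [← enc_input G r, ← hx]
    refine ⟨_, .comp (.pair (.id _) (.comp h₁ hy)) h₂, fun ht => ?_⟩
    have hxI : sz x ≤ I.eval G.enc.size := by
      simpa [I] using sz_input_le G r
    have hpp : t₁ ≤ (pp.comp I).eval G.enc.size := by
      rw [Polynomial.eval_comp]; exact ht₁.trans (pp.eval_mono_nat hxI)
    -- The preprocessing has written the encoding of `G'`, so its cost bounds that size.
    have hGt : G'.enc.size ≤ t₁ := by
      have := h₁.size_le.2
      simp only [Data.size] at this
      omega
    have htY : t ≤ Y.eval G.enc.size := by
      simp only [Y]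
      rw [Polynomial.eval_comp]
      exact ht.trans (pA.eval_mono_nat (hGt.trans hpp))
    have hy' : sz y ≤ t := hy.size_le.2
    have h₃ : t₂ ≤ (po.comp (I + Y + 1)).eval G.enc.size := by
      rw [Polynomial.eval_comp]
      refine ht₂.trans (po.eval_mono_nat ?_)
      rw [sz_prod]
      simp only [Polynomial.eval_add, Polynomial.eval_one]
      omega
    have hx' : (enc x).size ≤ I.eval G.enc.size := hxI
    simp only [Polynomial.eval_add, Polynomial.eval_one]
    omega
  refine ⟨fun r => ?_, hprob.trans (card_coins_le hle _ _ fun r hr => ?_)⟩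
  · obtain ⟨y, t, hy, ht⟩ := hrun fun i => r (Fin.castLE hle i)
    obtain ⟨u, hu, hu'⟩ := hfull r y t hy
    exact ⟨_, u, hu, hu' ht⟩
  · obtain ⟨c, t, hc, happrox⟩ := hr
    obtain ⟨u, hu, -⟩ := hfull r _ t hc
    refine ⟨_, u, hu, ?_⟩
    rw [toLabels_encLabels]
    refine isApprox_bestLabels G (hα _) (hβ _) hK hk (hlam₁ n) (hlam₁ _) hε hη hη₁ hηΛ
      (hside n) (fun hn => ?_) c happrox
    have hm : n ≤ n * (side K k n * side K k n) := by
      have := (side_spec hK k n).1.pos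
      exact Nat.le_mul_of_pos_right _ (by positivity)
    exact (hN n hn _ hm).imp_right fun h => ⟨h.1, h.2.trans hΛ⟩

end CorrClust

theorem mainTheorem3
    (S : ℕ → Set ℚ)
    (α β : ℕ → ℚ) (hα : ∀ m, 1 ≤ α m) (hβ : ∀ m, 1 ≤ β m)
    (hαc : CorrClust.PolyTimeComputable α) (hβc : CorrClust.PolyTimeComputable β)
    (δ : ℝ) (hδ₀ : 0 < δ) (hδ₁ : δ ≤ 1 / 2)
    (hαβ : (fun m : ℕ => ((α m : ℝ) + (β m : ℝ))) =O[Filter.atTop]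
      fun m : ℕ => (m : ℝ) ^ (1 / 2 - δ))
    (lam : ℕ → ℝ) (hlam₁ : ∀ m, 1 ≤ lam m) (hlam : Monotone lam ∨ Antitone lam)
    (hlog : lam =O[Filter.atTop] fun m : ℕ => Real.log (m : ℝ))
    (hA : CorrClust.RandPolyTimeApprox (fun m => {-α m, 0, β m}) lam) :
    ∀ ε : ℝ, 0 < ε → CorrClust.RandPolyTimeApprox S (fun n => lam n + ε) := fun _ hε => CorrClust.randPolyTimeApprox_of_restricted S hα hβ hαc hβc hδ₀ hδ₁ hαβ hlam₁ hlam hA hε
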